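/- **Setting.** Let $E$ be a finite set with a connected (undirected) neighbourhood structure $(S_x)_{x\in E}$, and let $E'\subset E$ be the set of feasible points. Let $U(x,\omega)\in[0,\infty]$ be a random cost, measurable in $\omega$, with $0\le U(x,\cdot)\le M<\infty$ for $x\in E'$ and $U(x,\cdot)=+\infty$ for $x\notin E'$. Let $P_x$ be the law of $\omega$ at $x$, and put $J(x)=\int U(x,\omega)\,dP_x(\omega)$, $J^\star=\min_E J$ and $\chi_\epsilon=\{x: J(x)\le J^\star+\epsilon\}$. Let $\mu_0$ be a probability on $E$ that charges every point of $E'$, and let $q_0$ be an irreducible, $\mu_0$-reversible transition probability on $E$ with $q_0(x,y)>0$ exactly when $y\in S_x$. For $x,y\in E$ let $$H_{x,y}=\min_{p}\max_{z\in p}J(z),$$ the minimum being over the paths $p$ from $x$ to $y$ in the neighbourhood structure, and let $$m^\star=\max_{x,y}\{H_{x,y}-\max(J(x),J(y))\}$$ (over the feasible $x,y$) be the maximal depth of a well that does not contain a fixed global minimum. **Algorithm.** Given an inverse temperature $\beta_t$ and a sampling intensity $n_t$, noisy simulated annealing (NSA) is the following Markov chain $(\tilde\chi_k,T_k,N_{T_k})_{k}$.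 It starts at $T_0=0$ from $\tilde\chi_0$. Given the past up to step $k$, with $\tilde\chi_k=x$: * $T_{k+1}=T_k+\xi_{k+1}$ with $\xi_{k+1}$ exponential of parameter $1$; * at time $t=T_{k+1}$ the sample size is $N=N_t\sim 1+\mathrm{Poisson}(n_t)$; * a candidate $y$ is drawn from $q_0(x,\cdot)$ and is accepted ($\tilde\chi_{k+1}=y$) with probability $\exp\big(-\tfrac{\beta_t}{N}\big(\sum_{i=1}^N U(y,\tilde\omega_i)-\sum_{i=1}^N U(x,\omega_i)\big)_+\big)$; otherwise $\tilde\chi_{k+1}=x$. Here the pairs $(\omega_i,\tilde\omega_i)$ are i.i.d. with a given joint law, depending on $(x,y)$, whose marginals are $P_x$ and $P_y$ (for instance independent draws or, if $P_x=P_y$, the same draw $\omega_i=\tilde\omega_i$). Let $\tilde X_t=\tilde\chi_k$ for $T_k\le t<T_{k+1}$; this is the point returned by NSA if it is stopped at time $t$. The computational cost up to time $T$ is $\mathbb E(N^T_{call})=\mathbb E\big(\sum_{k\ge1}\mathbf 1_{T_k<T}N_{T_k}\big)$. **Statement.** Suppose that $m^\star=0$, i.e. there is no well apart from the one containing the global minimum.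 Take $\beta_t=d(1+t)^b$ and $n_t=(1+t)^2$. There is a constant $c>0$, depending only on the setting ($E$, $S$, $\mu_0$, $q_0$, $U$ and the laws of the simulation conditions), such that the following holds whenever $d>0$ and either $0<b<1$, or $b=1$ and $d<c$. There is $\delta_0\in(0,1)$, depending only on the setting, on $b$ and on $d$, such that for all $\delta\in(0,\delta_0]$, all $\epsilon>0$ and every law of $\tilde X_0$ carried by $E'$, with $$T^\star=\max\Big\{\Big(\frac{2\log(1/\delta)}{d\epsilon}\Big)^{1/b}-1,\;0\Big\},$$ one has $$\Pr(\tilde X_{T^\star}\in\chi_\epsilon)\ge 1-\delta\qquad\text{and}\qquad \mathbb E\big(N_{call}^{T^\star}\big)\le\Big(\frac{2\log(1/\delta)}{d\epsilon}\Big)^{3/b}.$$ In particular, for $b=1$ an $\epsilon$-optimal point is returned by NSA with probability at least $1-\delta$ at an expected cost of at most $\big(\frac{2\log(1/\delta)}{d\epsilon}\big)^{3}$. -/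

import Mathlib

open MeasureTheory ProbabilityTheory
open scoped ENNReal NNReal

noncomputable section

/-- The setting of noisy simulated annealing on a finite space `E`, with simulation
conditions in `Ω`. Infinite costs are allowed, off the set `feasible`. -/
structure NSASetting (E Ω : Type*) [Fintype E] [DecidableEq E] [MeasurableSpace Ω] where
  /-- the neighbourhood structure: `S x` is the set of neighbours of `x` -/
  S : E → Set E
  S_symm : ∀ x y, y ∈ S x → x ∈ S y
  S_connected : ∀ x y, Relation.ReflTransGen (fun a b => b ∈ S a) x y
  /-- the set of points at which the cost is finite -/
  feasible : Set E
  /-- the reference probability, which charges every feasible point -/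
  mu0 : E → ℝ
  mu0_nonneg : ∀ x, 0 ≤ mu0 x
  mu0_sum : ∑ x, mu0 x = 1
  mu0_pos : ∀ x ∈ feasible, 0 < mu0 x
  /-- the proposition law: irreducible, reversible, and carried by the neighbourhoods -/
  q0 : Matrix E E ℝ
  q0_nonneg : ∀ x y, 0 ≤ q0 x y
  q0_sum : ∀ x, ∑ y, q0 x y = 1
  q0_irreducible : ∀ x y, ¬ Summable (fun n : ℕ => (q0 ^ n) x y)
  q0_reversible : ∀ x y, mu0 x * q0 x y = mu0 y * q0 y x
  q0_support : ∀ x y, 0 < q0 x y ↔ y ∈ S x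
  /-- the underlying random cost -/
  U : E → Ω → ℝ≥0∞
  U_measurable : ∀ x, Measurable (U x)
  /-- the bound for the cost -/
  M : ℝ≥0
  M_pos : 0 < M
  U_le : ∀ x ∈ feasible, ∀ ω, U x ω ≤ M
  U_top : ∀ x ∉ feasible, ∀ ω, U x ω = ∞
  /-- the law of the simulation conditions at the point `x` -/
  P : E → Measure Ω
  P_prob : ∀ x, IsProbabilityMeasure (P x)
  /-- the joint law of one pair of simulation conditions used to compare `x` (first
  coordinate) with a candidate `y` (second coordinate); it can be the product of `P x`
  and `P y` (independent draws), or, where `P x = P y`, the law of a pair `(ω, ω)`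
  (the same draw for both points) -/
  pairLaw : E → E → Measure (Ω × Ω)
  pairLaw_fst : ∀ x y, (pairLaw x y).map Prod.fst = P x
  pairLaw_snd : ∀ x y, (pairLaw x y).map Prod.snd = P y

/-- The parameters of the algorithm: the inverse temperature `β` and the sampling
intensity `n`, as functions of the time. -/
structure NSASchedule where
  β : ℝ≥0 → ℝ≥0
  n : ℝ≥0 → ℝ≥0
  β_measurable : Measurable β
  n_measurable : Measurable n

/-- The schedule `β_t = d (1 + t) ^ b`, `n_t = (1 + t) ^ 2`. -/
def polySchedule (d : ℝ≥0) (b : ℝ) : NSASchedule where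
  β t := d * (1 + t) ^ b
  n t := (1 + t) ^ 2
  β_measurable := by fun_prop
  n_measurable := by fun_prop

/-- `exp (-r z)` for `z` in `[0, ∞]`, with `exp (-∞) = 0`. -/
def boltzmann (r : ℝ≥0) (z : ℝ≥0∞) : ℝ≥0∞ :=
  if z = ∞ then 0 else ENNReal.ofReal (Real.exp (-(r * z.toReal)))

lemma boltzmann_le_one (r : ℝ≥0) (z : ℝ≥0∞) : boltzmann r z ≤ 1 := by
  unfold boltzmann
  split_ifs
  · exact zero_le
  · rw [ENNReal.ofReal_le_one, Real.exp_le_one_iff, neg_nonpos]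
    positivity

lemma measurable_boltzmann : Measurable (fun p : ℝ≥0 × ℝ≥0∞ => boltzmann p.1 p.2) := by
  unfold boltzmann
  refine Measurable.ite (measurable_snd (measurableSet_singleton ∞)) measurable_const ?_
  fun_prop

/-- The exponential waiting time of parameter `1`, as a law on `[0, ∞)`. -/
def waitLaw : Measure ℝ≥0 := (expMeasure 1).map Real.toNNReal

instance : IsProbabilityMeasure waitLaw := by
  have : IsProbabilityMeasure (expMeasure 1) := isProbabilityMeasure_expMeasure one_pos
  exact Measure.isProbabilityMeasure_map measurable_real_toNNReal.aemeasurable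

/-- Given the current jump time `t`, the law of the next one, `t + ξ`. -/
def waitKernel : Kernel ℝ≥0 ℝ≥0 :=
  (Kernel.id ×ₖ Kernel.const ℝ≥0 waitLaw).map (fun p => p.1 + p.2)

instance : IsMarkovKernel waitKernel :=
  Kernel.IsMarkovKernel.map _ (by fun_prop)

lemma measurable_poissonMeasure : Measurable poissonMeasure := by
  refine Measure.measurable_of_measurable_coe _ (fun s _ => ?_)
  have h : ∀ r : ℝ≥0, poissonMeasure r s
      = ∑' k : ℕ, s.indicator (fun k => ENNReal.ofReal (Real.exp (-r) * r ^ k / k.factorial)) k := by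
    intro r
    rw [← Measure.tsum_indicator_apply_singleton _ s (MeasurableSet.of_discrete)]
    refine tsum_congr (fun k => ?_)
    by_cases hk : k ∈ s
    · simp [hk, poissonMeasure_singleton]
    · simp [hk]
  simp_rw [h]
  refine Measurable.tsum (fun k => ?_)
  by_cases hk : k ∈ s
  · simp only [hk, Set.indicator_of_mem]
    fun_prop
  · simp [hk]

/-- At time `t`, the law of the sample size, which is one plus a Poisson variable of
parameter `n_t`. -/
def sizeKernel (σ : NSASchedule) : Kernel ℝ≥0 ℕ where
  toFun t := (poissonMeasure (σ.n t)).map (fun k => k + 1)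
  measurable' :=
    (Measure.measurable_map (fun k : ℕ => k + 1) (by fun_prop)).comp
      (measurable_poissonMeasure.comp σ.n_measurable)

instance (σ : NSASchedule) : IsMarkovKernel (sizeKernel σ) :=
  ⟨fun t => Measure.isProbabilityMeasure_map (μ := poissonMeasure (σ.n t))
    (f := fun k : ℕ => k + 1) (by fun_prop)⟩

namespace NSASetting

variable {E Ω : Type*} [Fintype E] [DecidableEq E] [MeasurableSpace Ω] (p : NSASetting E Ω)

/-- The expected cost. -/
def J (x : E) : ℝ≥0∞ := ∫⁻ ω, p.U x ω ∂(p.P x)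

/-- The set of `ε`-optimal points. -/
def nearOptimal (ε : ℝ) : Set E := {x | p.J x ≤ (⨅ y, p.J y) + ENNReal.ofReal ε}

/-- `w 0, …, w n` is a path from `x` to `y` in the neighbourhood structure. -/
def IsPath (x y : E) (n : ℕ) (w : ℕ → E) : Prop :=
  w 0 = x ∧ w n = y ∧ ∀ i < n, w (i + 1) ∈ p.S (w i)

/-- The lowest elevation of a path from `x` to `y`. -/
def elevation (x y : E) : ℝ≥0∞ :=
  ⨅ (n : ℕ) (w : ℕ → E) (_ : p.IsPath x y n w), ⨆ (i : ℕ) (_ : i ≤ n), p.J (w i)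

/-- The maximal depth of a well that does not contain a fixed global minimum. The
difference is never negative. It is `∞ - ∞ = 0` when `x` or `y` is infeasible, so that
only feasible endpoints count. -/
def mStar : ℝ≥0∞ := ⨆ (x : E) (y : E), p.elevation x y - max (p.J x) (p.J y)

instance (x y : E) : IsProbabilityMeasure (p.pairLaw x y) := by
  have h : IsProbabilityMeasure ((p.pairLaw x y).map Prod.fst) := by
    rw [p.pairLaw_fst]; exact p.P_prob x
  refine ⟨?_⟩
  rw [← h.measure_univ, Measure.map_apply measurable_fst MeasurableSet.univ, Set.preimage_univ]

/-- The probability of accepting `y` from `x`, with inverse temperature `r` and `N`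
simulations at each of the two points: the expectation of
`exp (-(r / N) (∑ i, U (y, ω̃ i) - ∑ i, U (x, ω i))₊)`. The subtraction on `[0, ∞]` is
truncated at `0`, which is the positive part. -/
def acceptProb (x y : E) (r : ℝ≥0) (N : ℕ) : ℝ≥0∞ :=
  ∫⁻ ω : Fin N → Ω × Ω,
    boltzmann (r / N) ((∑ i, p.U y (ω i).2) - ∑ i, p.U x (ω i).1)
      ∂(Measure.pi fun _ => p.pairLaw x y)

lemma acceptProb_le_one (x y : E) (r : ℝ≥0) (N : ℕ) : p.acceptProb x y r N ≤ 1 := by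
  unfold acceptProb
  calc _ ≤ ∫⁻ _ : Fin N → Ω × Ω, 1 ∂(Measure.pi fun _ => p.pairLaw x y) :=
        lintegral_mono (fun _ => boltzmann_le_one _ _)
    _ = 1 := by simp

lemma measurable_acceptProb (x y : E) (N : ℕ) :
    Measurable (fun r : ℝ≥0 => p.acceptProb x y r N) := by
  unfold acceptProb
  refine Measurable.lintegral_prod_right' (f := fun q : ℝ≥0 × (Fin N → Ω × Ω) =>
    boltzmann (q.1 / N) ((∑ i, p.U y (q.2 i).2) - ∑ i, p.U x (q.2 i).1)) ?_
  refine measurable_boltzmann.comp (Measurable.prodMk (by fun_prop) (Measurable.sub ?_ ?_))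
  · exact Finset.measurable_fun_sum _ (fun i _ => (p.U_measurable y).comp (by fun_prop))
  · exact Finset.measurable_fun_sum _ (fun i _ => (p.U_measurable x).comp (by fun_prop))

variable [MeasurableSpace E] [MeasurableSingletonClass E]

/-- The law of the next state, given the current state `x`, the time `t` of the jump and
the sample size `N`: a candidate `y` is drawn from `q0 x`, and is either accepted, or
rejected in favour of `x`. -/
def moveLaw (σ : NSASchedule) (x : E) (t : ℝ≥0) (N : ℕ) : Measure E :=
  ∑ y, ENNReal.ofReal (p.q0 x y) •
    (p.acceptProb x y (σ.β t) N • Measure.dirac y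
      + (1 - p.acceptProb x y (σ.β t) N) • Measure.dirac x)

instance (σ : NSASchedule) (x : E) (t : ℝ≥0) (N : ℕ) :
    IsProbabilityMeasure (p.moveLaw σ x t N) := by
  refine ⟨?_⟩
  have h : ∀ y, p.acceptProb x y (σ.β t) N + (1 - p.acceptProb x y (σ.β t) N) = 1 :=
    fun y => add_tsub_cancel_of_le (p.acceptProb_le_one x y _ N)
  simp only [moveLaw, Measure.coe_finsetSum, Finset.sum_apply, Measure.smul_apply,
    Measure.add_apply, measure_univ, smul_eq_mul, mul_one, h]
  rw [← ENNReal.ofReal_sum_of_nonneg (fun y _ => p.q0_nonneg x y), p.q0_sum, ENNReal.ofReal_one]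

/-- `moveLaw` as a kernel. -/
def moveKernel (σ : NSASchedule) : Kernel (E × ℝ≥0 × ℕ) E where
  toFun s := p.moveLaw σ s.1 s.2.1 s.2.2
  measurable' := by
    refine measurable_from_prod_countable_right (fun x => ?_)
    refine measurable_from_prod_countable_left (fun N => ?_)
    refine Measure.measurable_of_measurable_coe _ (fun s _ => ?_)
    simp only [moveLaw, Measure.coe_finsetSum, Finset.sum_apply, Measure.smul_apply,
      Measure.add_apply, smul_eq_mul]
    refine Finset.measurable_fun_sum _ (fun y _ => ?_)
    have h := (p.measurable_acceptProb x y N).comp σ.β_measurable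
    exact ((h.mul_const _).add ((measurable_const.sub h).mul_const _)).const_mul _

instance (σ : NSASchedule) : IsMarkovKernel (p.moveKernel σ) :=
  ⟨fun s => inferInstanceAs (IsProbabilityMeasure (p.moveLaw σ s.1 s.2.1 s.2.2))⟩

/-- One step of the algorithm. From the state `x` entered at the jump time `t`, draw the
next jump time `t'`, then the sample size `N'` at time `t'`, then the next state `x'`; the
result is `(x', t', N')`. -/
def step (σ : NSASchedule) : Kernel (E × ℝ≥0 × ℕ) (E × ℝ≥0 × ℕ) :=
  ((waitKernel.comap (fun s : E × ℝ≥0 × ℕ => s.2.1) (by fun_prop)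
      ⊗ₖ (sizeKernel σ).comap
        (fun s : (E × ℝ≥0 × ℕ) × ℝ≥0 => s.2) (by fun_prop))
    ⊗ₖ (p.moveKernel σ).comap
        (fun s : (E × ℝ≥0 × ℕ) × (ℝ≥0 × ℕ) => (s.1.1, s.2.1, s.2.2)) (by fun_prop)).map
    (fun s => (s.2, s.1.1, s.1.2))

instance (σ : NSASchedule) : IsMarkovKernel (p.step σ) :=
  Kernel.IsMarkovKernel.map _ (by fun_prop)

/-- The law of the Markov chain `(χ_k, T_k, N_k)` of the states, jump times and sample
sizes, with initial state of law `ν` and `T_0 = 0` (and the dummy value `N_0 = 0`). -/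
def law (σ : NSASchedule) (ν : Measure E) [IsProbabilityMeasure ν] :
    Measure (ℕ → E × ℝ≥0 × ℕ) :=
  haveI : IsProbabilityMeasure (ν.map (fun x => (x, (0 : ℝ≥0), (0 : ℕ)))) :=
    Measure.isProbabilityMeasure_map (by fun_prop)
  Kernel.trajMeasure (X := fun _ => E × ℝ≥0 × ℕ) (ν.map (fun x => (x, (0 : ℝ≥0), (0 : ℕ))))
    (fun k => (p.step σ).comap (fun h => h ⟨k, Finset.mem_Iic.2 le_rfl⟩) (by fun_prop))

/-- The probability that the state `X_t` of the algorithm at time `t`, which is `χ_k` if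
`T_k ≤ t < T_{k+1}`, lies in `A`. -/
def probAt (σ : NSASchedule) (ν : Measure E) [IsProbabilityMeasure ν] (t : ℝ≥0) (A : Set E) :
    ℝ≥0∞ :=
  p.law σ ν {h | ∃ k, (h k).2.1 ≤ t ∧ t < (h (k + 1)).2.1 ∧ (h k).1 ∈ A}

/-- The computational cost up to time `t`: the expectation of the sum of the sample sizes
`N_k` over the `k ≥ 1` with `T_k < t`. -/
def expectedCost (σ : NSASchedule) (ν : Measure E) [IsProbabilityMeasure ν] (t : ℝ≥0) : ℝ≥0∞ :=
  ∫⁻ h, ∑' k : ℕ, (if (h (k + 1)).2.1 < t then ((h (k + 1)).2.2 : ℝ≥0∞) else 0) ∂(p.law σ ν)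

end NSASetting

end

/-! The proof is a Lyapunov argument in continuous time. Write `gap x` for the excess of `J x` over
the minimum. It suffices to bound the expectation of exp((3/4) β_T gap) at time T by a constant `K`
independent of T, ε and δ (`exists_lintegral_exp_gap_le`). Markov's inequality then gives a failure
probability of at most K exp(-(3/4) β_T gap). Since β_T ε ≥ 2 log(1/δ), two thirds of the exponent
produce δ, and the remaining third absorbs `K` once δ is small, because positive gaps on a finite
set are bounded below.

Two estimates on the noisy acceptance probability drive the moment bound. A strictly uphill move of
height Δ is accepted with probability at most exp(-aβ) + exp(-κn) for any a < Δ, by Chernoff's bound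
(`exists_meanAccept_le`). A move that is not uphill is accepted with probability bounded below,
because the noise of the sample means is of order 1/√n and β/√n ≤ d (`exp_le_meanAccept`). Noise may
thus slow down the descent but cannot stop it.

If m* = 0, every nonoptimal point has a path to a strictly lower point that never exceeds its
starting level. Plateaus may have to be crossed, so exp((3/4) β gap) alone need not decrease; the
factor 2 - ρ^D, with `D` the length of a shortest such path, restores a strict drift (`exists_rank`,
`sum_lyapunov_le`). The growth of β adds a term proportional to β', which is dominated when β' is
eventually small: automatically for b < 1, and by d < c for b = 1 (`exists_drift`).

The jump chain is handled through supersolutions (`lintegral_tsum_le`), which give the terminal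
moment (`lintegral_terminal_le`), and the cost and non-explosion (`lintegral_cost_le`). -/

noncomputable section

/-! ### The law of the chain: Markov property and supersolutions. -/

namespace NSASetting

variable {E Ω : Type*} [Fintype E] [DecidableEq E] [MeasurableSpace Ω] (p : NSASetting E Ω)
variable [MeasurableSpace E] [MeasurableSingletonClass E]

instance (σ : NSASchedule) (ν : Measure E) [IsProbabilityMeasure ν] :
    IsProbabilityMeasure (p.law σ ν) := by
  have : IsProbabilityMeasure (ν.map (fun x => (x, (0 : ℝ≥0), (0 : ℕ)))) :=
    Measure.isProbabilityMeasure_map (by fun_prop)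
  unfold law
  infer_instance

lemma law_map_zero (σ : NSASchedule) (ν : Measure E) [IsProbabilityMeasure ν] :
    (p.law σ ν).map (fun h => h 0) = ν.map (fun x => (x, (0 : ℝ≥0), (0 : ℕ))) := by
  have : IsProbabilityMeasure (ν.map (fun x => (x, (0 : ℝ≥0), (0 : ℕ)))) :=
    Measure.isProbabilityMeasure_map (by fun_prop)
  unfold law Kernel.trajMeasure
  have h : (fun h : ℕ → E × ℝ≥0 × ℕ => h 0)
      = (fun g : (Finset.Iic 0 → E × ℝ≥0 × ℕ) => g ⟨0, Finset.mem_Iic.2 le_rfl⟩)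
        ∘ Preorder.frestrictLe (π := fun _ => E × ℝ≥0 × ℕ) 0 := rfl
  rw [h, ← Measure.map_map (by fun_prop) (by fun_prop), Measure.map_comp _ _ (by fun_prop),
    Kernel.traj_map_frestrictLe, Kernel.partialTraj_self, Measure.id_comp,
    Measure.map_map (by fun_prop) (by fun_prop)]
  exact Measure.map_id

/-- The Markov property at step `k`, read off the disintegration of the trajectory measure, whose
transition kernel depends only on the last coordinate of the history. -/
lemma lintegral_law_pair (σ : NSASchedule) (ν : Measure E) [IsProbabilityMeasure ν] (k : ℕ)
    {f : E × ℝ≥0 × ℕ → E × ℝ≥0 × ℕ → ℝ≥0∞} (hf : Measurable f.uncurry) :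
    ∫⁻ h, f (h k) (h (k + 1)) ∂(p.law σ ν)
      = ∫⁻ h, ∫⁻ s, f (h k) s ∂(p.step σ (h k)) ∂(p.law σ ν) := by
  have : IsProbabilityMeasure (ν.map (fun x => (x, (0 : ℝ≥0), (0 : ℕ)))) :=
    Measure.isProbabilityMeasure_map (by fun_prop)
  have key := Kernel.map_frestrictLe_trajMeasure_compProd_eq_map_trajMeasure
    (X := fun _ => E × ℝ≥0 × ℕ) (μ₀ := ν.map (fun x => (x, (0 : ℝ≥0), (0 : ℕ))))
    (κ := fun k => (p.step σ).comap
      (fun h : ((_ : Finset.Iic k) → E × ℝ≥0 × ℕ) => h ⟨k, Finset.mem_Iic.2 le_rfl⟩)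
      (by fun_prop)) (a := k)
  change (p.law σ ν).map _ ⊗ₘ _ = (p.law σ ν).map _ at key
  have hF : Measurable (fun q : ((_ : Finset.Iic k) → E × ℝ≥0 × ℕ) × (E × ℝ≥0 × ℕ) =>
      f (q.1 ⟨k, Finset.mem_Iic.2 le_rfl⟩) q.2) :=
    hf.comp (f := fun q : ((_ : Finset.Iic k) → E × ℝ≥0 × ℕ) × (E × ℝ≥0 × ℕ) =>
      (q.1 ⟨k, Finset.mem_Iic.2 le_rfl⟩, q.2)) (by fun_prop)
  have h1 := congrArg (fun m => ∫⁻ q, f (q.1 ⟨k, Finset.mem_Iic.2 le_rfl⟩) q.2 ∂m) key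
  rw [lintegral_map hF (by fun_prop), Measure.lintegral_compProd hF,
    lintegral_map (hF.lintegral_kernel_prod_right') (by fun_prop)] at h1
  exact h1.symm

/-- Supersolutions bound expected additive functionals of the chain. -/
lemma lintegral_tsum_le (σ : NSASchedule) (ν : Measure E) [IsProbabilityMeasure ν]
    {G : E × ℝ≥0 × ℕ → E × ℝ≥0 × ℕ → ℝ≥0∞} (hG : Measurable G.uncurry)
    {Ψ : E × ℝ≥0 × ℕ → ℝ≥0∞} (hΨ : Measurable Ψ)
    (hstep : ∀ s, ∫⁻ s', (G s s' + Ψ s') ∂(p.step σ s) ≤ Ψ s) :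
    ∫⁻ h, ∑' k : ℕ, G (h k) (h (k + 1)) ∂(p.law σ ν) ≤ ∫⁻ x, Ψ (x, 0, 0) ∂ν := by
  have hGk : ∀ k : ℕ, Measurable (fun h : ℕ → E × ℝ≥0 × ℕ => G (h k) (h (k + 1))) := fun k =>
    hG.comp (f := fun h : ℕ → E × ℝ≥0 × ℕ => (h k, h (k + 1))) (by fun_prop)
  rw [lintegral_tsum (fun k => (hGk k).aemeasurable)]
  have h0 : ∫⁻ h, Ψ (h 0) ∂(p.law σ ν) = ∫⁻ x, Ψ (x, 0, 0) ∂ν := by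
    rw [← lintegral_map (f := Ψ) (g := fun h : ℕ → E × ℝ≥0 × ℕ => h 0) hΨ (by fun_prop),
      law_map_zero, lintegral_map hΨ (by fun_prop)]
  -- Telescoping: the payoffs collected so far plus the expected potential never exceed the initial
  -- potential.
  have hpart : ∀ m : ℕ, ∑ k ∈ Finset.range m, ∫⁻ h, G (h k) (h (k + 1)) ∂(p.law σ ν)
      + ∫⁻ h, Ψ (h m) ∂(p.law σ ν) ≤ ∫⁻ x, Ψ (x, 0, 0) ∂ν := by
    intro m
    induction m with
    | zero => simp [h0]
    | succ m ih =>
      refine le_trans ?_ ih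
      rw [Finset.sum_range_succ, add_assoc]
      gcongr
      rw [← lintegral_add_left (hGk m)]
      have hm : Measurable (Function.uncurry fun s s' => G s s' + Ψ s') :=
        hG.add (hΨ.comp measurable_snd)
      rw [p.lintegral_law_pair σ ν m (f := fun s s' => G s s' + Ψ s') hm]
      exact lintegral_mono fun h => hstep (h m)
  refine ENNReal.tsum_le_of_sum_range_le fun m => le_trans le_self_add (hpart m)

end NSASetting

/-! ### Integrals against the exponential waiting time. -/

/-- The integral is written in the absolute time r = s + u, as a real variable, so that the
fundamental theorem of calculus applies to it later. -/
lemma lintegral_waitKernel (s : ℝ≥0) {f : ℝ≥0 → ℝ≥0∞} (hf : Measurable f) :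
    ∫⁻ t, f t ∂(waitKernel s)
      = ∫⁻ r in Set.Ioi (s : ℝ), ENNReal.ofReal (Real.exp (-(r - s))) * f r.toNNReal := by
  have hm : Measurable (fun u : ℝ => f (s + u.toNNReal)) := hf.comp (by fun_prop)
  have h1 : ∫⁻ t, f t ∂(waitKernel s) = ∫⁻ u, f (s + u) ∂waitLaw := by
    rw [waitKernel, Kernel.lintegral_map _ (by fun_prop) _ hf,
      Kernel.lintegral_prod _ _ _ (by fun_prop), Kernel.lintegral_id']
    · simp
    · exact Measurable.lintegral_kernel_prod_right' (κ := Kernel.const ℝ≥0 waitLaw)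
        (f := fun q : ℝ≥0 × ℝ≥0 => f (q.1 + q.2)) (hf.comp (by fun_prop))
  have hd : Measurable (exponentialPDF 1) :=
    (measurable_exponentialPDFReal 1).ennreal_ofReal
  have h2 : ∫⁻ u, f (s + u) ∂waitLaw
      = ∫⁻ u in Set.Ioi (0 : ℝ), ENNReal.ofReal (Real.exp (-u)) * f (s + u.toNNReal) := by
    rw [waitLaw, lintegral_map (by fun_prop) measurable_real_toNNReal]
    change ∫⁻ u : ℝ, f (s + u.toNNReal) ∂(volume.withDensity (exponentialPDF 1)) = _
    rw [lintegral_withDensity_eq_lintegral_mul _ hd hm,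
      ← setLIntegral_eq_of_support_subset (s := Set.Ici 0), setLIntegral_congr Ioi_ae_eq_Ici.symm]
    · refine setLIntegral_congr_fun measurableSet_Ioi fun u hu => ?_
      simp [exponentialPDF_of_nonneg (le_of_lt hu : (0 : ℝ) ≤ u)]
    · intro u hu
      by_contra h
      exact hu (by simp [exponentialPDF_of_neg (not_le.1 h : u < 0)])
  rw [h1, h2]
  have hpre : (fun r : ℝ => r - s) ⁻¹' Set.Ioi 0 = Set.Ioi (s : ℝ) := by ext; simp
  rw [← (measurePreserving_sub_right volume (s : ℝ)).setLIntegral_comp_preimage measurableSet_Ioi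
    (by fun_prop), hpre]
  refine setLIntegral_congr_fun measurableSet_Ioi fun r hr => ?_
  congr 2
  ext
  have h3 : (s : ℝ) < r := hr
  simp [Real.coe_toNNReal _ (sub_nonneg.2 h3.le), Real.coe_toNNReal r (s.2.trans h3.le)]

/-- Variation of constants for `exp (-r) Φ`. -/
lemma setLIntegral_exp_mul_sub_deriv {s T : ℝ} (hsT : s ≤ T) {Φ Φ' : ℝ → ℝ}
    (hΦ : ∀ r ∈ Set.Icc s T, HasDerivAt Φ (Φ' r) r) (hc : ContinuousOn Φ' (Set.Icc s T))
    (hnn : ∀ r ∈ Set.Icc s T, 0 ≤ Φ r - Φ' r) (hT : 0 ≤ Φ T) :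
    (∫⁻ r in Set.Ioc s T, ENNReal.ofReal (Real.exp (-(r - s)) * (Φ r - Φ' r)))
        + ENNReal.ofReal (Real.exp (-(T - s)) * Φ T) = ENNReal.ofReal (Φ s) := by
  have hcΦ : ContinuousOn Φ (Set.Icc s T) := fun r hr => (hΦ r hr).continuousAt.continuousWithinAt
  have hci : ContinuousOn (fun r => Real.exp (-(r - s)) * (Φ r - Φ' r)) (Set.Icc s T) := by
    fun_prop
  have hint : IntervalIntegrable (fun r => Real.exp (-(r - s)) * (Φ r - Φ' r)) volume s T :=
    ContinuousOn.intervalIntegrable (by rwa [Set.uIcc_of_le hsT])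
  have hftc := intervalIntegral.integral_eq_sub_of_hasDerivAt (a := s) (b := T)
    (f := fun r => -(Real.exp (-(r - s)) * Φ r))
    (f' := fun r => Real.exp (-(r - s)) * (Φ r - Φ' r)) (fun r hr => by
      rw [Set.uIcc_of_le hsT] at hr
      have h1 : HasDerivAt (fun r : ℝ => -(r - s)) (-1) r :=
        ((hasDerivAt_id r).sub_const s).neg
      refine ((h1.exp.mul (hΦ r hr)).neg).congr_deriv ?_
      ring) hint
  rw [intervalIntegral.integral_of_le hsT] at hftc
  rw [← ofReal_integral_eq_lintegral_ofReal
    (f := fun r => Real.exp (-(r - s)) * (Φ r - Φ' r)), hftc, ← ENNReal.ofReal_add]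
  · congr 1
    simp
  · rw [← hftc]
    exact setIntegral_nonneg measurableSet_Ioc fun r hr =>
      mul_nonneg (Real.exp_nonneg _) (hnn r (Set.Ioc_subset_Icc_self hr))
  · positivity
  · exact (intervalIntegrable_iff_integrableOn_Ioc_of_le hsT).1 hint
  · refine (ae_restrict_iff' measurableSet_Ioc).2 (Filter.Eventually.of_forall fun r hr => ?_)
    exact mul_nonneg (Real.exp_nonneg _) (hnn r (Set.Ioc_subset_Icc_self hr))

/-- For s ≤ T this is the probability of no jump in (s, T]; it accounts for the boundary term in
`setLIntegral_exp_mul_sub_deriv`. -/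
lemma setLIntegral_exp_Ioi (s T : ℝ) :
    ∫⁻ r in Set.Ioi T, ENNReal.ofReal (Real.exp (-(r - s)))
      = ENNReal.ofReal (Real.exp (-(T - s))) := by
  have h : ∀ r : ℝ, Real.exp (-(r - s)) = Real.exp s * Real.exp (-r) := fun r => by
    rw [← Real.exp_add]; ring_nf
  rw [← ofReal_integral_eq_lintegral_ofReal]
  · simp_rw [h]
    rw [integral_const_mul, integral_exp_neg_Ioi]
  · simp_rw [h]
    exact (integrableOn_exp_neg_Ioi T).const_mul _
  · exact Filter.Eventually.of_forall fun r => Real.exp_nonneg _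

/-! ### From one step of the chain to backward differential inequalities. -/

namespace NSASetting

variable {E Ω : Type*} [Fintype E] [DecidableEq E] [MeasurableSpace Ω] (p : NSASetting E Ω)
/-- Under the averaged sample size, the probability of accepting `y` from `x` at time `t`. -/
def meanAccept (σ : NSASchedule) (t : ℝ≥0) (x y : E) : ℝ≥0∞ :=
  ∫⁻ N, p.acceptProb x y (σ.β t) N ∂(sizeKernel σ t)

lemma meanAccept_le_one (σ : NSASchedule) (t : ℝ≥0) (x y : E) : p.meanAccept σ t x y ≤ 1 :=
  (lintegral_mono fun N => p.acceptProb_le_one x y _ N).trans (by simp)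

variable [MeasurableSpace E] [MeasurableSingletonClass E]

lemma lintegral_step (σ : NSASchedule) (s : E × ℝ≥0 × ℕ) {f : E × ℝ≥0 × ℕ → ℝ≥0∞}
    (hf : Measurable f) :
    ∫⁻ s', f s' ∂(p.step σ s)
      = ∫⁻ r in Set.Ioi (s.2.1 : ℝ), ENNReal.ofReal (Real.exp (-(r - s.2.1)))
          * ∫⁻ N, ∫⁻ x, f (x, r.toNNReal, N) ∂(p.moveLaw σ s.1 r.toNNReal N)
            ∂(sizeKernel σ r.toNNReal) := by
  have hg : Measurable (fun a : ((E × ℝ≥0 × ℕ) × (ℝ≥0 × ℕ)) × E => f (a.2, a.1.2.1, a.1.2.2)) :=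
    hf.comp (by fun_prop)
  have hmeas : Measurable fun q : (E × ℝ≥0 × ℕ) × (ℝ≥0 × ℕ) =>
      ∫⁻ x, f (x, q.2.1, q.2.2) ∂(p.moveLaw σ q.1.1 q.2.1 q.2.2) :=
    Measurable.lintegral_kernel_prod_right' (κ := (p.moveKernel σ).comap
        (fun s : (E × ℝ≥0 × ℕ) × (ℝ≥0 × ℕ) => (s.1.1, s.2.1, s.2.2)) (by fun_prop))
      (f := fun a => f (a.2, a.1.2.1, a.1.2.2)) hg
  have h2 : Measurable fun t : ℝ≥0 =>
      ∫⁻ N, ∫⁻ x, f (x, t, N) ∂(p.moveLaw σ s.1 t N) ∂(sizeKernel σ t) :=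
    Measurable.lintegral_kernel_prod_right' (κ := sizeKernel σ)
      (f := fun q : ℝ≥0 × ℕ => ∫⁻ x, f (x, q.1, q.2) ∂(p.moveLaw σ s.1 q.1 q.2))
      (hmeas.comp (f := fun q : ℝ≥0 × ℕ =>
        (fun q => q) ((s, q) : (E × ℝ≥0 × ℕ) × (ℝ≥0 × ℕ))) (by fun_prop))
  rw [← lintegral_waitKernel s.2.1 h2, step, Kernel.lintegral_map _ (by fun_prop) _ hf,
    Kernel.lintegral_compProd _ _ _ (by fun_prop), Kernel.lintegral_compProd]
  · rfl
  · exact hmeas.comp (f := fun q : ℝ≥0 × ℕ =>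
        (fun q => q) ((s, q) : (E × ℝ≥0 × ℕ) × (ℝ≥0 × ℕ))) (by fun_prop)

lemma lintegral_moveLaw (σ : NSASchedule) (t : ℝ≥0) (x : E) (F : E → ℝ≥0∞) :
    ∫⁻ N, ∫⁻ z, F z ∂(p.moveLaw σ x t N) ∂(sizeKernel σ t)
      = ∑ y, ENNReal.ofReal (p.q0 x y) * (p.meanAccept σ t x y * F y
          + (1 - p.meanAccept σ t x y) * F x) := by
  simp only [moveLaw, lintegral_finsetSum_measure, lintegral_smul_measure, lintegral_add_measure,
    lintegral_dirac, smul_eq_mul]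
  rw [lintegral_finsetSum _ (fun y _ => measurable_from_nat)]
  refine Finset.sum_congr rfl fun y _ => ?_
  rw [lintegral_const_mul _ measurable_from_nat, lintegral_add_left measurable_from_nat,
    lintegral_mul_const _ measurable_from_nat, lintegral_mul_const _ measurable_from_nat,
    lintegral_sub measurable_from_nat _ (Filter.Eventually.of_forall
      fun N => p.acceptProb_le_one x y _ N)]
  · simp [meanAccept]
  · exact ((p.meanAccept_le_one σ t x y).trans_lt ENNReal.one_lt_top).ne

/-- Converts the one-step average into φ plus the generator in real numbers. `F` may be infinite off
`S`: such points are never accepted, and 0 · ∞ = 0. -/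
lemma lintegral_moveLaw_ofReal (σ : NSASchedule) (t : ℝ≥0) {x : E} {S : Set E}
    (hS : ∀ y ∉ S, p.meanAccept σ t x y = 0) (hx : x ∈ S) {F : E → ℝ≥0∞} {φ : E → ℝ}
    (hF : ∀ y ∈ S, F y = ENNReal.ofReal (φ y)) (hφ : ∀ y ∈ S, 0 ≤ φ y) :
    ∫⁻ N, ∫⁻ z, F z ∂(p.moveLaw σ x t N) ∂(sizeKernel σ t)
      = ENNReal.ofReal (φ x + ∑ y, p.q0 x y * ((p.meanAccept σ t x y).toReal * (φ y - φ x))) ∧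
    0 ≤ φ x + ∑ y, p.q0 x y * ((p.meanAccept σ t x y).toReal * (φ y - φ x)) := by
  have hA : ∀ y, (p.meanAccept σ t x y).toReal ≤ 1 := fun y =>
    ENNReal.toReal_le_of_le_ofReal zero_le_one (by simpa using p.meanAccept_le_one σ t x y)
  have hsum : φ x + ∑ y, p.q0 x y * ((p.meanAccept σ t x y).toReal * (φ y - φ x))
      = ∑ y, p.q0 x y * ((p.meanAccept σ t x y).toReal * φ y
          + (1 - (p.meanAccept σ t x y).toReal) * φ x) := by
    have : φ x = ∑ y, p.q0 x y * φ x := by rw [← Finset.sum_mul, p.q0_sum, one_mul]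
    nth_rw 1 [this]
    rw [← Finset.sum_add_distrib]
    exact Finset.sum_congr rfl fun y _ => by ring
  have hterm : ∀ y, 0 ≤ (p.meanAccept σ t x y).toReal * φ y
      + (1 - (p.meanAccept σ t x y).toReal) * φ x := by
    intro y
    have h2 : 0 ≤ (1 - (p.meanAccept σ t x y).toReal) * φ x :=
      mul_nonneg (sub_nonneg.2 (hA y)) (hφ x hx)
    by_cases hy : y ∈ S
    · have := hφ y hy
      positivity
    · simpa [hS y hy] using hφ x hx
  rw [hsum]
  refine ⟨?_, Finset.sum_nonneg fun y _ => mul_nonneg (p.q0_nonneg x y) (hterm y)⟩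
  rw [lintegral_moveLaw, ENNReal.ofReal_sum_of_nonneg
    (fun y _ => mul_nonneg (p.q0_nonneg x y) (hterm y))]
  refine Finset.sum_congr rfl fun y _ => ?_
  rw [ENNReal.ofReal_mul (p.q0_nonneg x y)]
  congr 1
  by_cases hy : y ∈ S
  · have h1 : p.meanAccept σ t x y = ENNReal.ofReal (p.meanAccept σ t x y).toReal :=
      (ENNReal.ofReal_toReal ((p.meanAccept_le_one σ t x y).trans_lt ENNReal.one_lt_top).ne).symm
    have h2 : 0 ≤ 1 - (p.meanAccept σ t x y).toReal := sub_nonneg.2 (hA y)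
    have h3 := hφ y hy
    have h4 := hφ x hx
    rw [ENNReal.ofReal_add (by positivity) (by positivity), ENNReal.ofReal_mul (by positivity),
      ENNReal.ofReal_mul h2, ENNReal.ofReal_sub _ (by positivity), ← h1, hF y hy, hF x hx]
    simp
  · simp [hS y hy, hF x hx]

/-- `lintegral_tsum_le` with the step written out. -/
lemma lintegral_tsum_le_of_supersolution (σ : NSASchedule) (ν : Measure E)
    [IsProbabilityMeasure ν] {G : E × ℝ≥0 × ℕ → E × ℝ≥0 × ℕ → ℝ≥0∞} (hG : Measurable G.uncurry)
    {Ψ : E × ℝ≥0 × ℕ → ℝ≥0∞} (hΨ : Measurable Ψ)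
    (hstep : ∀ x (s : ℝ≥0) n, ∫⁻ r in Set.Ioi (s : ℝ), ENNReal.ofReal (Real.exp (-(r - s)))
        * ∫⁻ N, ∫⁻ z, (G (x, s, n) (z, r.toNNReal, N) + Ψ (z, r.toNNReal, N))
            ∂(p.moveLaw σ x r.toNNReal N) ∂(sizeKernel σ r.toNNReal) ≤ Ψ (x, s, n)) :
    ∫⁻ h, ∑' k : ℕ, G (h k) (h (k + 1)) ∂(p.law σ ν) ≤ ∫⁻ x, Ψ (x, 0, 0) ∂ν := by
  refine p.lintegral_tsum_le σ ν hG hΨ ?_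
  rintro ⟨x, s, n⟩
  have hm : Measurable fun s' => G (x, s, n) s' + Ψ s' :=
    (hG.comp (measurable_prodMk_left (x := (x, s, n)))).add hΨ
  rw [p.lintegral_step σ _ hm]
  exact hstep x s n

/-- A supersolution of the backward equation bounds the expectation of its terminal value along
the process. -/
lemma lintegral_terminal_le (σ : NSASchedule) (ν : Measure E) [IsProbabilityMeasure ν] (T : ℝ≥0)
    (S : Set E) [DecidablePred (· ∈ S)] (hS : ∀ t, ∀ x ∈ S, ∀ y ∉ S, p.meanAccept σ t x y = 0)
    {Φ Φ' : ℝ → E → ℝ} (hmeas : ∀ x, Measurable fun r => Φ r x)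
    (hderiv : ∀ x ∈ S, ∀ r ∈ Set.Icc (0 : ℝ) T, HasDerivAt (fun r => Φ r x) (Φ' r x) r)
    (hcont : ∀ x ∈ S, ContinuousOn (fun r => Φ' r x) (Set.Icc (0 : ℝ) T))
    (hnn : ∀ x ∈ S, ∀ r ∈ Set.Icc (0 : ℝ) T, 0 ≤ Φ r x)
    (hsup : ∀ x ∈ S, ∀ r ∈ Set.Icc (0 : ℝ) T,
      Φ' r x + ∑ y, p.q0 x y * ((p.meanAccept σ r.toNNReal x y).toReal * (Φ r y - Φ r x)) ≤ 0) :
    ∫⁻ h, ∑' k : ℕ, (if (h k).2.1 ≤ T ∧ T < (h (k + 1)).2.1 then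
        (if (h k).1 ∈ S then ENNReal.ofReal (Φ T (h k).1) else ∞) else 0) ∂(p.law σ ν)
      ≤ ∫⁻ x, (if x ∈ S then ENNReal.ofReal (Φ 0 x) else ∞) ∂ν := by
  -- The value ∞ off `S` makes the supersolution inequality trivial there.
  set Ψ₀ : ℝ → E → ℝ≥0∞ := fun r x => if x ∈ S then ENNReal.ofReal (Φ r x) else ∞ with hΨ₀
  have hΨ₀m : Measurable fun q : E × ℝ≥0 × ℕ => Ψ₀ q.2.1 q.1 := by
    refine measurable_from_prod_countable_right fun x => ?_
    by_cases hx : x ∈ S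
    · simp only [hΨ₀, hx, if_true]
      exact ((hmeas x).comp (f := fun q : ℝ≥0 × ℕ => (q.1 : ℝ)) (by fun_prop)).ennreal_ofReal
    · simp only [hΨ₀, hx, if_false]
      exact measurable_const
  have hle : MeasurableSet {q : E × ℝ≥0 × ℕ | q.2.1 ≤ T} :=
    measurableSet_le (by fun_prop) (by fun_prop)
  have hG : Measurable (Function.uncurry fun s s' : E × ℝ≥0 × ℕ =>
      if s.2.1 ≤ T ∧ T < s'.2.1 then Ψ₀ T s.1 else 0) := by
    refine Measurable.ite ?_ ?_ measurable_const
    · exact (measurableSet_le (by fun_prop) (by fun_prop)).inter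
        (measurableSet_lt (by fun_prop) (by fun_prop))
    · exact (measurable_of_finite (Ψ₀ T)).comp (by fun_prop)
  -- After `T` the terminal payoff has already been collected, so the potential is 0.
  have hΨ : Measurable fun q : E × ℝ≥0 × ℕ => if q.2.1 ≤ T then Ψ₀ q.2.1 q.1 else 0 :=
    Measurable.ite hle hΨ₀m measurable_const
  refine (p.lintegral_tsum_le_of_supersolution σ ν hG hΨ ?_).trans (by simp [hΨ₀])
  intro x s n
  dsimp only
  by_cases hsT : s ≤ T
  swap
  · rw [if_neg hsT, nonpos_iff_eq_zero]
    refine (setLIntegral_congr_fun measurableSet_Ioi fun r hr => ?_).trans lintegral_zero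
    have h1 : ¬ r.toNNReal ≤ T := by
      rw [Real.toNNReal_le_iff_le_coe, not_le]
      exact (NNReal.coe_lt_coe.2 (not_le.1 hsT)).trans hr
    simp [hsT, h1]
  by_cases hx : x ∈ S
  swap
  · simp [hsT, hΨ₀, hx]
  have hsT' : (s : ℝ) ≤ T := hsT
  -- A next jump in (s, T] continues with the potential; a next jump after `T` pays Φ_T at the
  -- current state. These are the two terms of the variation of constants formula.
  rw [← Set.Ioc_union_Ioi_eq_Ioi hsT', lintegral_union measurableSet_Ioi
    (Set.Ioc_disjoint_Ioi le_rfl)]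
  have hsub : Set.Icc (s : ℝ) T ⊆ Set.Icc (0 : ℝ) T := Set.Icc_subset_Icc_left s.2
  have hkey : ∀ r ∈ Set.Icc (s : ℝ) T, _ := fun r hr =>
    p.lintegral_moveLaw_ofReal σ r.toNNReal (F := Ψ₀ r) (φ := Φ r)
      (hS r.toNNReal x hx) hx (fun y hy => by simp [hΨ₀, hy]) (fun y hy => hnn y hy r (hsub hr))
  have hpos : ∀ r ∈ Set.Icc (s : ℝ) T, 0 ≤ Φ r x - Φ' r x := fun r hr => by
    linarith [(hkey r hr).2, hsup x hx r (hsub hr)]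
  have h1 := setLIntegral_exp_mul_sub_deriv hsT' (fun r hr => hderiv x hx r (hsub hr))
    ((hcont x hx).mono hsub) hpos (hnn x hx T ⟨T.2, le_rfl⟩)
  simp only [hsT, if_true, true_and]
  have h2 : Ψ₀ s x = ENNReal.ofReal (Φ s x) := by simp [hΨ₀, hx]
  rw [h2, ← h1]
  refine add_le_add ?_ (le_of_eq ?_)
  · refine setLIntegral_mono' measurableSet_Ioc fun r hr => ?_
    have hr' := Set.Ioc_subset_Icc_self hr
    have hr0 : 0 ≤ r := (hsub hr').1
    have h3 : r.toNNReal ≤ T := Real.toNNReal_le_iff_le_coe.2 hr.2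
    simp only [h3, if_true, not_lt.2 h3, if_false, zero_add, Real.coe_toNNReal r hr0]
    rw [(hkey r hr').1, ← ENNReal.ofReal_mul (Real.exp_nonneg _)]
    refine ENNReal.ofReal_le_ofReal (mul_le_mul_of_nonneg_left ?_ (Real.exp_nonneg _))
    linarith [hsup x hx r (hsub hr')]
  · rw [ENNReal.ofReal_mul (Real.exp_nonneg _), ← setLIntegral_exp_Ioi,
      ← lintegral_mul_const _ (by fun_prop)]
    refine setLIntegral_congr_fun measurableSet_Ioi fun r hr => ?_
    have h3 : T < r.toNNReal := Real.lt_toNNReal_iff_coe_lt.2 hr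
    simp [h3, not_le.2 h3, hΨ₀, hx]

/-- The expected value of a sum, over the jump times before `T`, of a function of the sample
size. -/
lemma lintegral_cost_le (σ : NSASchedule) (ν : Measure E) [IsProbabilityMeasure ν] (T : ℝ≥0)
    (c : ℕ → ℝ≥0∞) {m P : ℝ → ℝ} (hm : ∀ r : ℝ≥0, ∫⁻ N, c N ∂(sizeKernel σ r)
      = ENNReal.ofReal (m r)) (hm0 : ∀ r, 0 ≤ r → 0 ≤ m r) (hmc : Continuous m)
    (hP : ∀ r, HasDerivAt P (m r) r) :
    ∫⁻ h, ∑' k : ℕ, (if (h (k + 1)).2.1 < T then c (h (k + 1)).2.2 else 0) ∂(p.law σ ν)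
      ≤ ENNReal.ofReal (P T - P 0) := by
  have hPT : ∀ r, 0 ≤ r → r ≤ (T : ℝ) → P r ≤ P T := by
    intro r hr hrT
    have := intervalIntegral.integral_eq_sub_of_hasDerivAt (a := r) (b := T)
      (fun r _ => hP r) (hmc.intervalIntegrable _ _)
    have h2 : 0 ≤ ∫ u in r..T, m u :=
      intervalIntegral.integral_nonneg hrT fun u hu => hm0 u (hr.trans hu.1)
    linarith
  have hPc : Continuous P := continuous_iff_continuousAt.2 fun r => (hP r).continuousAt
  have hG : Measurable (Function.uncurry fun _ s' : E × ℝ≥0 × ℕ =>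
      if s'.2.1 < T then c s'.2.2 else 0) := by
    refine Measurable.ite (measurableSet_lt (by fun_prop) (by fun_prop)) ?_ measurable_const
    exact (measurable_from_nat (f := c)).comp (by fun_prop)
  -- Jumps occur at rate 1, so P T - P s, the integral of the mean `m` over [s, T], is the expected
  -- cost still to come.
  have hΨ : Measurable fun q : E × ℝ≥0 × ℕ =>
      if q.2.1 ≤ T then ENNReal.ofReal (P T - P q.2.1) else 0 :=
    Measurable.ite (measurableSet_le (by fun_prop) (by fun_prop)) (by fun_prop) measurable_const
  refine (p.lintegral_tsum_le_of_supersolution σ ν hG hΨ ?_).trans (by simp)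
  intro x s n
  dsimp only
  by_cases hsT : s ≤ T
  swap
  · rw [if_neg hsT, nonpos_iff_eq_zero]
    refine (setLIntegral_congr_fun measurableSet_Ioi fun r hr => ?_).trans lintegral_zero
    have h1 : ¬ r.toNNReal ≤ T := by
      rw [Real.toNNReal_le_iff_le_coe, not_le]
      exact (NNReal.coe_lt_coe.2 (not_le.1 hsT)).trans hr
    have h2 : ¬ r.toNNReal < T := fun h => h1 h.le
    simp [h1, h2]
  have hsT' : (s : ℝ) ≤ T := hsT
  rw [← Set.Ioc_union_Ioi_eq_Ioi hsT', lintegral_union measurableSet_Ioi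
    (Set.Ioc_disjoint_Ioi le_rfl)]
  have h1 := setLIntegral_exp_mul_sub_deriv (Φ := fun r => P T - P r) (Φ' := fun r => - m r) hsT'
    (fun r _ => (hP r).const_sub _) (by fun_prop)
    (fun r hr => by
      have h0 : 0 ≤ r := le_trans s.2 hr.1
      have := hPT r h0 hr.2
      have := hm0 r h0
      linarith) (by simp)
  simp only [hsT, if_true]
  rw [← h1]
  refine add_le_add ?_ (le_of_eq ?_)
  · refine setLIntegral_mono' measurableSet_Ioc fun r hr => ?_
    have hr0 : 0 ≤ r := le_trans s.2 hr.1.le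
    have h3 : r.toNNReal ≤ T := Real.toNNReal_le_iff_le_coe.2 hr.2
    rw [ENNReal.ofReal_mul (Real.exp_nonneg _)]
    gcongr
    calc _ ≤ ∫⁻ N, (c N + ENNReal.ofReal (P T - P r)) ∂(sizeKernel σ r.toNNReal) := by
          refine lintegral_mono fun N => ?_
          refine (lintegral_mono (g := fun _ => c N + ENNReal.ofReal (P T - P r))
            fun z => ?_).trans (by simp)
          simp only [h3, if_true, Real.coe_toNNReal r hr0]
          gcongr
          split_ifs <;> simp
      _ = ENNReal.ofReal (m r) + ENNReal.ofReal (P T - P r) := by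
          rw [lintegral_add_right _ measurable_const, hm, Real.coe_toNNReal r hr0]
          simp
      _ = ENNReal.ofReal (P T - P r - -m r) := by
          rw [← ENNReal.ofReal_add (hm0 r hr0) (sub_nonneg.2 (hPT r hr0 hr.2))]
          congr 1
          ring
  · refine (setLIntegral_congr_fun measurableSet_Ioi fun r hr => ?_).trans
      (lintegral_zero.trans (by simp))
    have h3 : T < r.toNNReal := Real.lt_toNNReal_iff_coe_lt.2 hr
    simp [h3.le.not_gt, not_le.2 h3]

end NSASetting

/-! ### Jensen, Poisson and Chernoff estimates. -/

/-- Jensen's inequality for `exp (-z)`. -/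
lemma ofReal_exp_neg_le_lintegral {α : Type*} [MeasurableSpace α] {μ : Measure α}
    [IsProbabilityMeasure μ] {z : α → ℝ} (hz : Measurable z) {z₀ : ℝ} (hz₀ : 0 ≤ z₀)
    (hle : ∫⁻ a, ENNReal.ofReal (z a) ∂μ ≤ ENNReal.ofReal z₀) :
    ENNReal.ofReal (Real.exp (-z₀)) ≤ ∫⁻ a, ENNReal.ofReal (Real.exp (-(z a))) ∂μ := by
  -- The tangent line of exp(-z) at z₀, with the negative term moved to the other side to avoid
  -- truncated subtraction.
  have hpt : ∀ a, ENNReal.ofReal (Real.exp (-z₀) * (1 + z₀))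
      ≤ ENNReal.ofReal (Real.exp (-(z a))) + ENNReal.ofReal (Real.exp (-z₀)) *
        ENNReal.ofReal (z a) := by
    intro a
    have h1 : Real.exp (-(z a)) = Real.exp (-z₀) * Real.exp (z₀ - z a) := by
      rw [← Real.exp_add]; ring_nf
    have h2 := Real.add_one_le_exp (z₀ - z a)
    rw [← ENNReal.ofReal_mul (Real.exp_nonneg _)]
    refine (ENNReal.ofReal_le_ofReal ?_).trans ENNReal.ofReal_add_le
    rw [h1, ← mul_add]
    exact mul_le_mul_of_nonneg_left (by linarith) (Real.exp_nonneg _)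
  have hint := lintegral_mono (μ := μ) hpt
  rw [lintegral_add_left (by fun_prop), lintegral_const_mul _ (by fun_prop), lintegral_const,
    measure_univ, mul_one] at hint
  have h3 : ENNReal.ofReal (Real.exp (-z₀) * (1 + z₀))
      = ENNReal.ofReal (Real.exp (-z₀)) + ENNReal.ofReal (Real.exp (-z₀)) * ENNReal.ofReal z₀ := by
    rw [mul_one_add, ENNReal.ofReal_add (by positivity) (by positivity),
      ENNReal.ofReal_mul (Real.exp_nonneg _)]
  rw [h3] at hint
  refine (ENNReal.add_le_add_iff_right (a := ENNReal.ofReal (Real.exp (-z₀)) * ENNReal.ofReal z₀)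
    (ENNReal.mul_ne_top ENNReal.ofReal_ne_top ENNReal.ofReal_ne_top)).1 (hint.trans ?_)
  gcongr

lemma lintegral_pi_prod_eq_pow {α : Type*} [MeasurableSpace α] (μ : Measure α)
    [IsProbabilityMeasure μ] {f : α → ℝ≥0∞} (hf : Measurable f) (N : ℕ) :
    ∫⁻ ω : Fin N → α, ∏ i, f (ω i) ∂(Measure.pi fun _ => μ) = (∫⁻ a, f a ∂μ) ^ N := by
  have h := lintegral_prod_eq_prod_lintegral_of_indepFun (μ := Measure.pi fun _ : Fin N => μ)
    Finset.univ (fun i ω => f (ω i))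
    (iIndepFun_pi (X := fun _ => f) fun i => hf.aemeasurable) (fun i => by fun_prop)
  rw [h]
  have h2 : ∀ i : Fin N, ∫⁻ ω, f (ω i) ∂(Measure.pi fun _ : Fin N => μ) = ∫⁻ a, f a ∂μ := by
    intro i
    exact (measurePreserving_eval (fun _ : Fin N => μ) i).lintegral_comp hf
  simp [h2]

lemma lintegral_sizeKernel (σ : NSASchedule) (t : ℝ≥0) (f : ℕ → ℝ≥0∞) :
    ∫⁻ N, f N ∂(sizeKernel σ t)
      = ∑' k : ℕ, ENNReal.ofReal (Real.exp (-(σ.n t)) * (σ.n t) ^ k / k.factorial) * f (k + 1) := by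
  change ∫⁻ N, f N ∂((poissonMeasure (σ.n t)).map (fun k => k + 1)) = _
  rw [lintegral_map measurable_from_nat measurable_from_nat, lintegral_countable']
  exact tsum_congr fun k => by rw [poissonMeasure_singleton, mul_comm]

/-- The Poisson generating function; the extra factor ρ coming from the 1 in 1 + Poisson is dropped.
-/
lemma lintegral_sizeKernel_pow_le (σ : NSASchedule) (t : ℝ≥0) {ρ : ℝ} (h0 : 0 ≤ ρ) (h1 : ρ ≤ 1) :
    ∫⁻ N, ENNReal.ofReal ρ ^ N ∂(sizeKernel σ t)
      ≤ ENNReal.ofReal (Real.exp (-((1 - ρ) * σ.n t))) := by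
  rw [lintegral_sizeKernel]
  have hs : HasSum (fun k : ℕ => Real.exp (-(σ.n t)) * ((σ.n t : ℝ) ^ k / k.factorial * ρ ^ k))
      (Real.exp (-(σ.n t)) * Real.exp (ρ * σ.n t)) := by
    refine HasSum.mul_left _ ?_
    have := NormedSpace.expSeries_div_hasSum_exp (𝔸 := ℝ) (ρ * σ.n t)
    rw [← Real.exp_eq_exp_ℝ] at this
    convert! this using 2 with k
    rw [mul_pow]; ring
  have he : Real.exp (-((1 - ρ) * σ.n t)) = Real.exp (-(σ.n t)) * Real.exp (ρ * σ.n t) := by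
    rw [← Real.exp_add]; ring_nf
  rw [he, ← hs.tsum_eq, ENNReal.ofReal_tsum_of_nonneg (fun k => by positivity) hs.summable]
  refine ENNReal.tsum_le_tsum fun k => ?_
  rw [← ENNReal.ofReal_pow h0, ← ENNReal.ofReal_mul (by positivity)]
  refine ENNReal.ofReal_le_ofReal ?_
  rw [mul_div_assoc, mul_assoc]
  gcongr _ * (_ * ?_)
  exact pow_le_pow_of_le_one h0 h1 k.le_succ

lemma tsum_poisson (r : ℝ≥0) :
    ∑' k : ℕ, ENNReal.ofReal (Real.exp (-r) * r ^ k / k.factorial) = 1 := by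
  have h := hasSum_one_poissonMeasure r
  rw [← ENNReal.ofReal_tsum_of_nonneg (fun k => by positivity) h.summable, h.tsum_eq,
    ENNReal.ofReal_one]

/-- Dividing the Poisson weight of k by k + 1 gives the weight of k + 1 divided by n, and the
shifted weights sum to at most 1. -/
lemma lintegral_sizeKernel_inv_le (σ : NSASchedule) (t : ℝ≥0) (hn : 0 < σ.n t) :
    ∫⁻ N, ENNReal.ofReal (1 / (N : ℝ)) ∂(sizeKernel σ t) ≤ ENNReal.ofReal (1 / σ.n t) := by
  rw [lintegral_sizeKernel]
  have hn' : (0 : ℝ) < σ.n t := hn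
  have h : ∀ k : ℕ, ENNReal.ofReal (Real.exp (-(σ.n t)) * (σ.n t) ^ k / k.factorial)
        * ENNReal.ofReal (1 / ((k + 1 : ℕ) : ℝ))
      = ENNReal.ofReal (Real.exp (-(σ.n t)) * (σ.n t) ^ (k + 1) / (k + 1).factorial)
        * ENNReal.ofReal (1 / σ.n t) := by
    intro k
    rw [← ENNReal.ofReal_mul (by positivity), ← ENNReal.ofReal_mul (by positivity)]
    congr 1
    rw [Nat.factorial_succ, pow_succ]
    push_cast
    field_simp
  simp_rw [h]
  rw [ENNReal.tsum_mul_right]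
  refine mul_le_of_le_one_left zero_le ?_
  rw [← tsum_poisson (σ.n t)]
  exact ENNReal.tsum_comp_le_tsum_of_injective (add_left_injective 1) _

lemma lintegral_sizeKernel_id (σ : NSASchedule) (t : ℝ≥0) :
    ∫⁻ N, (N : ℝ≥0∞) ∂(sizeKernel σ t) = ENNReal.ofReal (1 + σ.n t) := by
  rw [lintegral_sizeKernel]
  simp only [Nat.cast_add, Nat.cast_one, mul_add, mul_one]
  rw [ENNReal.tsum_add, tsum_poisson, tsum_eq_zero_add' ENNReal.summable]
  have h : ∀ k : ℕ, ENNReal.ofReal (Real.exp (-(σ.n t)) * (σ.n t) ^ (k + 1) / (k + 1).factorial)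
        * ((k + 1 : ℕ) : ℝ≥0∞)
      = ENNReal.ofReal (Real.exp (-(σ.n t)) * (σ.n t) ^ k / k.factorial)
        * ENNReal.ofReal (σ.n t) := by
    intro k
    rw [← ENNReal.ofReal_natCast, ← ENNReal.ofReal_mul (by positivity),
      ← ENNReal.ofReal_mul (by positivity)]
    congr 1
    rw [Nat.factorial_succ, pow_succ]
    push_cast
    field_simp
  simp_rw [h]
  rw [ENNReal.tsum_mul_right, tsum_poisson, ENNReal.ofReal_add zero_le_one (by positivity)]
  simp [add_comm]

/-- Chernoff's argument: at s = 0 the integral equals 1 and has derivative a - m < 0, where m is the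
mean of `D`. -/
lemma exists_integral_exp_neg_lt_one {α : Type*} [MeasurableSpace α] {μ : Measure α}
    [IsProbabilityMeasure μ] {D : α → ℝ} (hD : Measurable D) {M a : ℝ} (hM : ∀ ω, |D ω| ≤ M)
    (ha : a < ∫ ω, D ω ∂μ) :
    ∃ s : ℝ, 0 ≤ s ∧ ∫ ω, Real.exp (-(s * (D ω - a))) ∂μ < 1 := by
  set m := ∫ ω, D ω ∂μ
  have hint : Integrable D μ :=
    Integrable.of_bound hD.aestronglyMeasurable M (Filter.Eventually.of_forall hM)
  have hM0 : 0 ≤ M := (abs_nonneg _).trans (hM (Classical.choice μ.nonempty_of_neZero))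
  set B := M + |a| + 1
  have hB : 0 < B := by positivity
  have hDa : ∀ ω, |D ω - a| ≤ B := fun ω => by
    have := abs_sub (D ω) a
    linarith [hM ω]
  -- The first bound gives |s(D - a)| ≤ 1, where exp(z) ≤ 1 + z + z²; the second keeps the quadratic
  -- term below half of the linear gain.
  set s := min (1 / B) ((m - a) / (2 * B ^ 2))
  have hs : 0 < s := lt_min (by positivity) (div_pos (sub_pos.2 ha) (by positivity))
  have hsB : s * B ≤ 1 := by
    have : s ≤ 1 / B := min_le_left _ _
    rwa [le_div_iff₀ hB] at this
  have hsB2 : s * B ^ 2 ≤ (m - a) / 2 := by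
    have : s ≤ (m - a) / (2 * B ^ 2) := min_le_right _ _
    rw [le_div_iff₀ (by positivity)] at this
    linarith
  have hpt : ∀ ω, Real.exp (-(s * (D ω - a))) ≤ 1 + s * a + s * (s * B ^ 2) - s * D ω := by
    intro ω
    have h1 : |-(s * (D ω - a))| ≤ s * B := by
      rw [abs_neg, abs_mul, abs_of_pos hs]
      exact mul_le_mul_of_nonneg_left (hDa ω) hs.le
    have h2 := Real.abs_exp_sub_one_sub_id_le (h1.trans hsB)
    have h3 : (-(s * (D ω - a))) ^ 2 ≤ (s * B) ^ 2 := sq_le_sq' (by linarith [abs_le.1 h1])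
      (by linarith [abs_le.1 h1])
    have h4 := (abs_le.1 h2).2
    nlinarith
  refine ⟨s, hs.le, ?_⟩
  calc ∫ ω, Real.exp (-(s * (D ω - a))) ∂μ
      ≤ ∫ ω, (1 + s * a + s * (s * B ^ 2) - s * D ω) ∂μ := by
        refine integral_mono_of_nonneg (Filter.Eventually.of_forall fun ω => Real.exp_nonneg _)
          ((integrable_const _).sub (hint.const_mul s)) (Filter.Eventually.of_forall hpt)
    _ = 1 + s * a + s * (s * B ^ 2) - s * m := by
        rw [integral_sub (integrable_const _) (hint.const_mul s), integral_const_mul]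
        simp [m]
    _ < 1 := by nlinarith [mul_pos hs (sub_pos.2 ha)]

/-! ### Bounds on the acceptance probability. -/

namespace NSASetting

variable {E Ω : Type*} [Fintype E] [DecidableEq E] [MeasurableSpace Ω] (p : NSASetting E Ω)

/-- The difference of the costs at `y` and `x`, for one pair of simulation conditions. -/
def costDiff (x y : E) (ω : Ω × Ω) : ℝ := (p.U y ω.2).toReal - (p.U x ω.1).toReal

lemma measurable_costDiff (x y : E) : Measurable (p.costDiff x y) :=
  (((p.U_measurable y).comp measurable_snd).ennreal_toReal).sub
    (((p.U_measurable x).comp measurable_fst).ennreal_toReal)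

variable {p} in
lemma U_ne_top {x : E} (hx : x ∈ p.feasible) (ω : Ω) : p.U x ω ≠ ∞ :=
  ((p.U_le x hx ω).trans_lt ENNReal.coe_lt_top).ne

variable {p} in
lemma toReal_U_le {x : E} (hx : x ∈ p.feasible) (ω : Ω) : (p.U x ω).toReal ≤ p.M :=
  ENNReal.toReal_le_coe_of_le_coe (p.U_le x hx ω)

lemma abs_costDiff_le {x y : E} (hx : x ∈ p.feasible) (hy : y ∈ p.feasible) (ω : Ω × Ω) :
    |p.costDiff x y ω| ≤ p.M := by
  have h1 := toReal_U_le hx ω.1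
  have h2 := toReal_U_le hy ω.2
  have h3 : 0 ≤ (p.U x ω.1).toReal := ENNReal.toReal_nonneg
  have h4 : 0 ≤ (p.U y ω.2).toReal := ENNReal.toReal_nonneg
  rw [costDiff, abs_le]
  constructor <;> linarith

/-- Only the marginals of the pair law enter, so the coupling of the two draws plays no role in the
mean. -/
lemma integral_costDiff {x y : E} (hx : x ∈ p.feasible) (hy : y ∈ p.feasible) :
    ∫ ω, p.costDiff x y ω ∂(p.pairLaw x y) = (p.J y).toReal - (p.J x).toReal := by
  have key : ∀ z ∈ p.feasible, ∀ f : Ω × Ω → Ω, Measurable f →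
      (p.pairLaw x y).map f = p.P z →
      Integrable (fun ω => (p.U z (f ω)).toReal) (p.pairLaw x y) ∧
      ∫ ω, (p.U z (f ω)).toReal ∂(p.pairLaw x y) = (p.J z).toReal := by
    intro z hz f hf hmap
    have hm : Measurable fun ω => p.U z (f ω) := (p.U_measurable z).comp hf
    refine ⟨Integrable.of_bound hm.ennreal_toReal.aestronglyMeasurable p.M
      (Filter.Eventually.of_forall fun ω => ?_), ?_⟩
    · rw [Real.norm_of_nonneg ENNReal.toReal_nonneg]
      exact toReal_U_le hz _
    · rw [integral_toReal hm.aemeasurable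
        (Filter.Eventually.of_forall fun ω => (U_ne_top hz _).lt_top), J, ← hmap,
        lintegral_map (p.U_measurable z) hf]
  obtain ⟨i1, e1⟩ := key x hx Prod.fst measurable_fst (p.pairLaw_fst x y)
  obtain ⟨i2, e2⟩ := key y hy Prod.snd measurable_snd (p.pairLaw_snd x y)
  simp only [costDiff]
  rw [integral_sub i2 i1, e1, e2]

lemma boltzmann_sum {x y : E} (hx : x ∈ p.feasible) (hy : y ∈ p.feasible) (r : ℝ≥0) {N : ℕ}
    (ω : Fin N → Ω × Ω) :
    boltzmann r ((∑ i, p.U y (ω i).2) - ∑ i, p.U x (ω i).1)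
      = ENNReal.ofReal (Real.exp (-(r * max (∑ i, p.costDiff x y (ω i)) 0))) := by
  have h : ∀ z ∈ p.feasible, ∀ f : Fin N → Ω,
      ∑ i, p.U z (f i) = ENNReal.ofReal (∑ i, (p.U z (f i)).toReal) := by
    intro z hz f
    rw [ENNReal.ofReal_sum_of_nonneg fun i _ => ENNReal.toReal_nonneg]
    exact Finset.sum_congr rfl fun i _ => (ENNReal.ofReal_toReal (U_ne_top hz _)).symm
  rw [h y hy (fun i => (ω i).2), h x hx (fun i => (ω i).1),
    ← ENNReal.ofReal_sub _ (Finset.sum_nonneg fun i _ => ENNReal.toReal_nonneg), boltzmann,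
    if_neg ENNReal.ofReal_ne_top, ENNReal.toReal_ofReal', ← Finset.sum_sub_distrib]
  rfl

lemma acceptProb_eq {x y : E} (hx : x ∈ p.feasible) (hy : y ∈ p.feasible) (r : ℝ≥0) (N : ℕ) :
    p.acceptProb x y r N = ∫⁻ ω : Fin N → Ω × Ω,
      ENNReal.ofReal (Real.exp (-(r / N * max (∑ i, p.costDiff x y (ω i)) 0)))
        ∂(Measure.pi fun _ => p.pairLaw x y) := by
  simp [acceptProb, boltzmann_sum p hx hy]

/-- If the sample mean of the differences is at least `a`, the Boltzmann factor is at most exp(-ra).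
Otherwise the exponential product is at least 1, and by independence it integrates to an N-th power.
-/
lemma acceptProb_le {x y : E} (hx : x ∈ p.feasible) (hy : y ∈ p.feasible) (r : ℝ≥0) {N : ℕ}
    (hN : N ≠ 0) {a s : ℝ} (hs : 0 ≤ s) :
    p.acceptProb x y r N ≤ ENNReal.ofReal (Real.exp (-(r * a)))
      + (∫⁻ ω, ENNReal.ofReal (Real.exp (-(s * (p.costDiff x y ω - a)))) ∂(p.pairLaw x y)) ^ N := by
  have hmD := p.measurable_costDiff x y
  rw [acceptProb_eq p hx hy, ← lintegral_pi_prod_eq_pow _ (by fun_prop)]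
  calc _ ≤ ∫⁻ ω : Fin N → Ω × Ω, (ENNReal.ofReal (Real.exp (-(r * a)))
        + ∏ i, ENNReal.ofReal (Real.exp (-(s * (p.costDiff x y (ω i) - a)))))
        ∂(Measure.pi fun _ => p.pairLaw x y) := by
        refine lintegral_mono fun ω => ?_
        rw [← ENNReal.ofReal_prod_of_nonneg fun i _ => Real.exp_nonneg _, ← Real.exp_sum]
        by_cases h : N * a ≤ ∑ i, p.costDiff x y (ω i)
        · refine le_add_right (ENNReal.ofReal_le_ofReal (Real.exp_le_exp.2 (neg_le_neg ?_)))
          have hN' : (0 : ℝ) < N := by positivity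
          calc (r : ℝ) * a = r / N * (N * a) := by field_simp
            _ ≤ _ := by
              gcongr
              exact h.trans (le_max_left _ _)
        · refine le_add_left (ENNReal.ofReal_le_ofReal (Real.exp_le_exp.2 ?_))
          have h1 : ∑ i, -(s * (p.costDiff x y (ω i) - a))
              = s * (N * a - ∑ i, p.costDiff x y (ω i)) := by
            rw [Finset.sum_neg_distrib, ← Finset.mul_sum, Finset.sum_sub_distrib]
            simp only [Finset.sum_const, Finset.card_univ, Fintype.card_fin, nsmul_eq_mul]
            ring
          rw [h1]
          have h2 : 0 ≤ s * (N * a - ∑ i, p.costDiff x y (ω i)) :=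
            mul_nonneg hs (sub_nonneg.2 (not_le.1 h).le)
          have h3 : (0 : ℝ) ≤ r / N * max (∑ i, p.costDiff x y (ω i)) 0 := by positivity
          linarith
    _ = _ := by
        rw [lintegral_add_left measurable_const, lintegral_const, measure_univ, mul_one]

lemma ae_sizeKernel_ne_zero (σ : NSASchedule) (t : ℝ≥0) : ∀ᵐ N ∂(sizeKernel σ t), N ≠ 0 := by
  change ∀ᵐ N ∂((poissonMeasure (σ.n t)).map (fun k => k + 1)), N ≠ 0
  rw [ae_map_iff (by fun_prop) (MeasurableSet.of_discrete)]
  simp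

/-- Uphill moves are exponentially rare, up to the probability of a large deviation of the
sample means. -/
lemma exists_meanAccept_le {x y : E} (hx : x ∈ p.feasible) (hy : y ∈ p.feasible) {a : ℝ}
    (haJ : a < (p.J y).toReal - (p.J x).toReal) :
    ∃ κ : ℝ, 0 < κ ∧ ∀ (σ : NSASchedule) (t : ℝ≥0), (p.meanAccept σ t x y).toReal
      ≤ Real.exp (-(σ.β t * a)) + Real.exp (-(κ * σ.n t)) := by
  have hmD := p.measurable_costDiff x y
  obtain ⟨s, hs, hlt⟩ := exists_integral_exp_neg_lt_one (μ := p.pairLaw x y) hmD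
    (p.abs_costDiff_le hx hy) (a := a) (by rwa [p.integral_costDiff hx hy])
  set ρ := ∫ ω, Real.exp (-(s * (p.costDiff x y ω - a))) ∂(p.pairLaw x y)
  have hρ0 : 0 ≤ ρ := integral_nonneg fun ω => Real.exp_nonneg _
  have hρ : ∫⁻ ω, ENNReal.ofReal (Real.exp (-(s * (p.costDiff x y ω - a)))) ∂(p.pairLaw x y)
      = ENNReal.ofReal ρ := by
    refine (ofReal_integral_eq_lintegral_ofReal ?_
      (Filter.Eventually.of_forall fun ω => Real.exp_nonneg _)).symm
    refine Integrable.of_bound (by fun_prop) (Real.exp (s * (p.M + a)))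
      (Filter.Eventually.of_forall fun ω => ?_)
    rw [Real.norm_of_nonneg (Real.exp_nonneg _), Real.exp_le_exp]
    have := (abs_le.1 (p.abs_costDiff_le hx hy ω)).1
    nlinarith
  refine ⟨1 - ρ, sub_pos.2 hlt, fun σ t => ENNReal.toReal_le_of_le_ofReal (by positivity) ?_⟩
  calc p.meanAccept σ t x y
      ≤ ∫⁻ N, (ENNReal.ofReal (Real.exp (-(σ.β t * a))) + ENNReal.ofReal ρ ^ N)
          ∂(sizeKernel σ t) := by
        refine lintegral_mono_ae ((ae_sizeKernel_ne_zero σ t).mono fun N hN => ?_)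
        rw [← hρ]
        exact p.acceptProb_le hx hy _ hN hs
    _ ≤ _ := by
        rw [lintegral_add_left measurable_const, lintegral_const, measure_univ, mul_one,
          ENNReal.ofReal_add (Real.exp_nonneg _) (Real.exp_nonneg _)]
        gcongr
        exact lintegral_sizeKernel_pow_le σ t hρ0 hlt.le

/-- Because N ≥ 1, at least one infinite cost is drawn at `y`, while the sum at `x` is finite. The
feasible set is therefore never left. -/
lemma meanAccept_eq_zero (σ : NSASchedule) (t : ℝ≥0) {x y : E} (hx : x ∈ p.feasible)
    (hy : y ∉ p.feasible) : p.meanAccept σ t x y = 0 := by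
  rw [meanAccept, lintegral_eq_zero_iff measurable_from_nat]
  refine (ae_sizeKernel_ne_zero σ t).mono fun N hN => ?_
  have hne : Nonempty (Fin N) := ⟨⟨0, Nat.pos_of_ne_zero hN⟩⟩
  simp only [acceptProb, Pi.zero_apply]
  refine (lintegral_congr fun ω => ?_).trans lintegral_zero
  have h1 : ∑ i, p.U x (ω i).1 ≠ ∞ := ENNReal.sum_ne_top.2 fun i _ => U_ne_top hx _
  have h2 : ∑ i, p.U y (ω i).2 = ∞ :=
    ENNReal.sum_eq_top.2 ⟨hne.some, Finset.mem_univ _, p.U_top y hy _⟩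
  simp [h2, ENNReal.top_sub h1, boltzmann]

lemma lintegral_costDiff_sq_le {x y : E} (hx : x ∈ p.feasible) (hy : y ∈ p.feasible) (N : ℕ) :
    ∫⁻ ω : Fin N → Ω × Ω, ENNReal.ofReal ((∑ i, p.costDiff x y (ω i)
        - N * ((p.J y).toReal - (p.J x).toReal)) ^ 2) ∂(Measure.pi fun _ => p.pairLaw x y)
      ≤ ENNReal.ofReal (N * p.M ^ 2) := by
  have hmD := p.measurable_costDiff x y
  have hLp : MemLp (p.costDiff x y) 2 (p.pairLaw x y) :=
    MemLp.of_bound hmD.aestronglyMeasurable p.M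
      (Filter.Eventually.of_forall (p.abs_costDiff_le hx hy))
  have hLpi : ∀ i : Fin N, MemLp (fun ω : Fin N → Ω × Ω => p.costDiff x y (ω i)) 2
      (Measure.pi fun _ => p.pairLaw x y) := fun i =>
    hLp.comp_measurePreserving (measurePreserving_eval (fun _ : Fin N => p.pairLaw x y) i)
  have hvar := variance_sum_pi (μ := fun _ : Fin N => p.pairLaw x y)
    (X := fun _ => p.costDiff x y) (fun _ => hLp)
  have hmean : ∫ ω, (∑ i, fun ω : Fin N → Ω × Ω => p.costDiff x y (ω i)) ω
      ∂(Measure.pi fun _ => p.pairLaw x y) = N * ((p.J y).toReal - (p.J x).toReal) := by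
    simp only [Finset.sum_apply]
    rw [integral_finsetSum _ fun i _ => (hLpi i).integrable (by norm_num)]
    have : ∀ i : Fin N, ∫ ω, p.costDiff x y (ω i) ∂(Measure.pi fun _ : Fin N => p.pairLaw x y)
        = (p.J y).toReal - (p.J x).toReal := by
      intro i
      rw [← p.integral_costDiff hx hy]
      exact integral_comp_eval (i := i) (μ := fun _ : Fin N => p.pairLaw x y)
        hmD.aestronglyMeasurable
    simp [this, mul_sub]
  have hev := evariance_eq_lintegral_ofReal (∑ i, fun ω : Fin N → Ω × Ω => p.costDiff x y (ω i))
    (Measure.pi fun _ => p.pairLaw x y)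
  rw [hmean, ← (memLp_finsetSum' Finset.univ fun i _ => hLpi i).ofReal_variance_eq, hvar] at hev
  simp only [Finset.sum_apply] at hev
  rw [← hev]
  refine ENNReal.ofReal_le_ofReal ?_
  have hv : Var[p.costDiff x y; p.pairLaw x y] ≤ (p.M : ℝ) ^ 2 := by
    refine (variance_le_expectation_sq hmD.aestronglyMeasurable).trans ?_
    calc ∫ ω, (p.costDiff x y ^ 2) ω ∂(p.pairLaw x y) ≤ ∫ _, (p.M : ℝ) ^ 2 ∂(p.pairLaw x y) := by
          refine integral_mono_of_nonneg (Filter.Eventually.of_forall fun ω => sq_nonneg _)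
            (integrable_const _) (Filter.Eventually.of_forall fun ω => ?_)
          exact sq_le_sq' (by linarith [abs_le.1 (p.abs_costDiff_le hx hy ω)])
            (by linarith [abs_le.1 (p.abs_costDiff_le hx hy ω)])
      _ = _ := by simp
  simpa using mul_le_mul_of_nonneg_left hv (Nat.cast_nonneg N)

/-- By Jensen it suffices to bound the mean of the exponent. The mean difference is nonpositive, so
the positive part is at most the fluctuation, whose average over N draws is of order 1/√N. -/
lemma exp_le_acceptProb {x y : E} (hx : x ∈ p.feasible) (hy : y ∈ p.feasible)
    (hJ : (p.J y).toReal ≤ (p.J x).toReal) (r : ℝ≥0) {N : ℕ} (hN : N ≠ 0) :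
    ENNReal.ofReal (Real.exp (-(r * ((p.M ^ 2 + 1) / 2) / √N))) ≤ p.acceptProb x y r N := by
  have hmD := p.measurable_costDiff x y
  rw [acceptProb_eq p hx hy]
  refine ofReal_exp_neg_le_lintegral (by fun_prop) (by positivity) ?_
  set m := (p.J y).toReal - (p.J x).toReal with hm
  have hN0 : (0 : ℝ) < N := by positivity
  have hsq : 0 < √(N : ℝ) := Real.sqrt_pos.2 hN0
  have hNs : √(N : ℝ) * √N = N := Real.mul_self_sqrt hN0.le
  have hpt : ∀ S : ℝ, (r : ℝ) / N * max S 0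
      ≤ r / (2 * √N * N) * (S - N * m) ^ 2 + r / (2 * √N) := by
    intro S
    have h1 : max S 0 ≤ |S - N * m| := by
      have : N * m ≤ 0 := mul_nonpos_of_nonneg_of_nonpos hN0.le (by linarith)
      exact max_le ((by linarith : S ≤ S - N * m).trans (le_abs_self _)) (abs_nonneg _)
    -- The arithmetic-geometric inequality with weight √N, which balances the variance, of order N.
    have h2 : |S - N * m| ≤ ((S - N * m) ^ 2 / √N + √N) / 2 := by
      have h3 : 0 ≤ (|S - N * m| - √N) ^ 2 / √N := by positivity
      have h4 : (|S - N * m| - √N) ^ 2 / √N = (S - N * m) ^ 2 / √N + √N - 2 * |S - N * m| := by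
        rw [sub_sq, sq_abs]
        field_simp
        ring
      linarith
    calc (r : ℝ) / N * max S 0 ≤ r / N * (((S - N * m) ^ 2 / √N + √N) / 2) := by
          gcongr
          exact h1.trans h2
      _ = r / (2 * √N * N) * (S - N * m) ^ 2 + r / N * √N / 2 := by
          field_simp
      _ = _ := by
          congr 1
          nth_rw 1 [← hNs]
          field_simp
  calc _ ≤ ∫⁻ ω : Fin N → Ω × Ω, (ENNReal.ofReal (r / (2 * √N * N)) *
          ENNReal.ofReal ((∑ i, p.costDiff x y (ω i) - N * m) ^ 2)
          + ENNReal.ofReal (r / (2 * √N))) ∂(Measure.pi fun _ => p.pairLaw x y) := by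
        refine lintegral_mono fun ω => ?_
        rw [← ENNReal.ofReal_mul (by positivity), ← ENNReal.ofReal_add (by positivity)
          (by positivity)]
        exact ENNReal.ofReal_le_ofReal (hpt _)
    _ ≤ ENNReal.ofReal (r / (2 * √N * N)) * ENNReal.ofReal (N * p.M ^ 2)
          + ENNReal.ofReal (r / (2 * √N)) := by
        rw [lintegral_add_right _ measurable_const, lintegral_const_mul _ (by fun_prop),
          lintegral_const, measure_univ, mul_one]
        gcongr
        exact p.lintegral_costDiff_sq_le hx hy N
    _ = _ := by
        rw [← ENNReal.ofReal_mul (by positivity), ← ENNReal.ofReal_add (by positivity)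
          (by positivity)]
        congr 1
        field_simp

/-- Moves that do not go uphill keep a positive probability of being accepted. -/
lemma exp_le_meanAccept (σ : NSASchedule) (t : ℝ≥0) (hn : 0 < σ.n t) {x y : E}
    (hx : x ∈ p.feasible) (hy : y ∈ p.feasible) (hJ : (p.J y).toReal ≤ (p.J x).toReal) :
    Real.exp (-(σ.β t * ((p.M ^ 2 + 1) / 2) / √(σ.n t))) ≤ (p.meanAccept σ t x y).toReal := by
  rw [← ENNReal.ofReal_le_iff_le_toReal
    ((p.meanAccept_le_one σ t x y).trans_lt ENNReal.one_lt_top).ne]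
  set C : ℝ := σ.β t * ((p.M ^ 2 + 1) / 2) with hC
  have hC0 : 0 ≤ C := by positivity
  have hn0 : (0 : ℝ) < σ.n t := hn
  have hs : 0 < √(σ.n t : ℝ) := Real.sqrt_pos.2 hn0
  have hss : √(σ.n t : ℝ) * √(σ.n t) = σ.n t := Real.mul_self_sqrt hn0.le
  refine le_trans (ofReal_exp_neg_le_lintegral (μ := sizeKernel σ t)
    (z := fun N : ℕ => C / √N) measurable_from_nat (by positivity) ?_)
    (lintegral_mono_ae ((ae_sizeKernel_ne_zero σ t).mono fun N hN =>
      p.exp_le_acceptProb hx hy hJ _ hN))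
  -- The inequality 1/√N ≤ (√n / N + 1/√n)/2 makes the bound linear in 1/N, whose mean is at most
  -- 1/n.
  calc _ ≤ ∫⁻ N : ℕ, (ENNReal.ofReal (C * √(σ.n t) / 2) * ENNReal.ofReal (1 / (N : ℝ))
          + ENNReal.ofReal (C / √(σ.n t) / 2)) ∂(sizeKernel σ t) := by
        refine lintegral_mono_ae ((ae_sizeKernel_ne_zero σ t).mono fun N hN => ?_)
        rw [← ENNReal.ofReal_mul (by positivity), ← ENNReal.ofReal_add (by positivity)
          (by positivity)]
        refine ENNReal.ofReal_le_ofReal ?_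
        have hN0 : (0 : ℝ) < N := by positivity
        have hsN : 0 < √(N : ℝ) := Real.sqrt_pos.2 hN0
        have hNs : √(N : ℝ) ^ 2 = N := Real.sq_sqrt hN0.le
        set a := √(σ.n t : ℝ)
        set b := √(N : ℝ)
        have h3 : 0 ≤ C * ((a - b) ^ 2 / (2 * a * b ^ 2)) := by positivity
        rw [← hNs]
        have h4 : C * a / 2 * (1 / b ^ 2) + C / a / 2 - C / b
            = C * ((a - b) ^ 2 / (2 * a * b ^ 2)) := by
          field_simp
          ring
        linarith
    _ ≤ ENNReal.ofReal (C * √(σ.n t) / 2) * ENNReal.ofReal (1 / σ.n t)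
          + ENNReal.ofReal (C / √(σ.n t) / 2) := by
        rw [lintegral_add_right _ measurable_const, lintegral_const_mul _ measurable_from_nat,
          lintegral_const, measure_univ, mul_one]
        gcongr
        exact lintegral_sizeKernel_inv_le σ t hn
    _ = _ := by
        rw [← ENNReal.ofReal_mul (by positivity), ← ENNReal.ofReal_add (by positivity)
          (by positivity)]
        congr 1
        rw [show 1 / (σ.n t : ℝ) = 1 / (√(σ.n t : ℝ) * √(σ.n t)) by rw [hss]]
        field_simp
        ring

/-! ### The gap, and descent paths in the absence of wells. -/

lemma J_ne_top {x : E} (hx : x ∈ p.feasible) : p.J x ≠ ∞ := by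
  have := p.P_prob x
  have h : p.J x ≤ p.M := (lintegral_mono fun ω => p.U_le x hx ω).trans (by simp)
  exact (h.trans_lt ENNReal.coe_lt_top).ne

lemma toReal_J_le {x : E} (hx : x ∈ p.feasible) : (p.J x).toReal ≤ p.M := by
  have := p.P_prob x
  exact ENNReal.toReal_le_coe_of_le_coe
    ((lintegral_mono fun ω => p.U_le x hx ω).trans (by simp))

lemma J_eq_top {x : E} (hx : x ∉ p.feasible) : p.J x = ∞ := by
  have := p.P_prob x
  simp [J, p.U_top x hx]

lemma mem_feasible_of_J_le {x y : E} (hx : x ∈ p.feasible) (h : p.J y ≤ p.J x) :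
    y ∈ p.feasible := by
  by_contra hy
  rw [p.J_eq_top hy, top_le_iff] at h
  exact p.J_ne_top hx h

/-- The excess of the expected cost over its minimum. -/
def gap (x : E) : ℝ := (p.J x).toReal - (⨅ y, p.J y).toReal

variable {p} in
lemma gap_nonneg {x : E} (hx : x ∈ p.feasible) : 0 ≤ p.gap x :=
  sub_nonneg.2 (ENNReal.toReal_mono (p.J_ne_top hx) (iInf_le _ x))

variable {p} in
lemma gap_le {x : E} (hx : x ∈ p.feasible) : p.gap x ≤ p.M := by
  have h1 := p.toReal_J_le hx
  have h2 : 0 ≤ (⨅ y, p.J y).toReal := ENNReal.toReal_nonneg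
  rw [gap]
  linarith

lemma J_le_iff_gap_le {x y : E} (hx : x ∈ p.feasible) (hy : y ∈ p.feasible) :
    p.J x ≤ p.J y ↔ p.gap x ≤ p.gap y := by
  rw [← ENNReal.toReal_le_toReal (p.J_ne_top hx) (p.J_ne_top hy), gap, gap]
  constructor <;> intro h <;> linarith

lemma J_lt_iff_gap_lt {x y : E} (hx : x ∈ p.feasible) (hy : y ∈ p.feasible) :
    p.J x < p.J y ↔ p.gap x < p.gap y := by
  rw [← not_le, ← not_le, p.J_le_iff_gap_le hy hx]

lemma exists_gap_eq_zero {x : E} (hx : x ∈ p.feasible) :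
    ∃ z ∈ p.feasible, p.gap z = 0 := by
  have : Nonempty E := ⟨x⟩
  obtain ⟨z, hz⟩ := exists_eq_ciInf_of_finite (f := p.J)
  exact ⟨z, p.mem_feasible_of_J_le hx (hz ▸ iInf_le _ x), by rw [gap, hz, sub_self]⟩

lemma mem_nearOptimal_iff {x : E} (hx : x ∈ p.feasible) {ε : ℝ} (hε : 0 ≤ ε) :
    x ∈ p.nearOptimal ε ↔ p.gap x ≤ ε := by
  have hinf : (⨅ y, p.J y) ≠ ∞ := ne_top_of_le_ne_top (p.J_ne_top hx) (iInf_le _ x)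
  change p.J x ≤ _ ↔ _
  rw [← ENNReal.toReal_le_toReal (p.J_ne_top hx) (ENNReal.add_ne_top.2
    ⟨hinf, ENNReal.ofReal_ne_top⟩), ENNReal.toReal_add hinf ENNReal.ofReal_ne_top,
    ENNReal.toReal_ofReal hε, gap, sub_le_iff_le_add']

/-- Without wells, the optimal elevation is attained at an endpoint of some path. -/
lemma exists_isPath_J_le (hm : p.mStar = 0) {x y : E} (hx : x ∈ p.feasible)
    (hyx : p.J y ≤ p.J x) : ∃ n w, p.IsPath x y n w ∧ ∀ i ≤ n, p.J (w i) ≤ p.J x := by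
  have hel : p.elevation x y ≤ p.J x := by
    have h : p.elevation x y - max (p.J x) (p.J y) ≤ p.mStar :=
      le_iSup₂_of_le (f := fun x y => p.elevation x y - max (p.J x) (p.J y)) x y le_rfl
    rw [hm, nonpos_iff_eq_zero, tsub_eq_zero_iff_le, max_eq_left hyx] at h
    exact h
  -- The least cost strictly above `J x`. A path of elevation below this value stays at level at
  -- most `J x`, so it is not necessary to attain the infimum over paths.
  set m := (Finset.univ.filter fun z => p.J x < p.J z).inf p.J
  have hlt : p.J x < m := by
    rw [Finset.lt_inf_iff (p.J_ne_top hx).lt_top]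
    simp
  have h := hel.trans_lt hlt
  simp only [elevation, iInf_lt_iff] at h
  obtain ⟨n, w, hp, hw⟩ := h
  refine ⟨n, w, hp, fun i hi => ?_⟩
  by_contra hcon
  have h1 : m ≤ p.J (w i) := Finset.inf_le (by simpa using hcon)
  have h2 : p.J (w i) ≤ ⨆ (i : ℕ) (_ : i ≤ n), p.J (w i) :=
    le_iSup₂_of_le (f := fun i (_ : i ≤ n) => p.J (w i)) i hi le_rfl
  exact absurd (h1.trans h2) (not_le.2 hw)

/-- Without wells, there is a rank along which the cost can be lowered by moves that never go
uphill. -/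
lemma exists_rank (hm : p.mStar = 0) : ∃ D : E → ℕ, ∀ x ∈ p.feasible,
    (p.gap x = 0 → D x = 0) ∧ (0 < p.gap x → 0 < D x ∧ ∃ y ∈ p.feasible, y ∈ p.S x ∧
      (p.gap y < p.gap x ∨ p.gap y = p.gap x ∧ D y < D x)) := by
  -- The lengths of paths from `x` to a strictly lower point that never exceed the level of `x`. The
  -- rank is the infimum; at a minimum the set is empty and `sInf` gives 0.
  let L : E → Set ℕ := fun x => {n | ∃ w : ℕ → E, w 0 = x ∧ (∀ i < n, w (i + 1) ∈ p.S (w i)) ∧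
    (∀ i ≤ n, p.J (w i) ≤ p.J x) ∧ p.J (w n) < p.J x}
  refine ⟨fun x => sInf (L x), fun x hx => ⟨fun h0 => ?_, fun hpos => ?_⟩⟩
  · have : L x = ∅ := by
      rw [Set.eq_empty_iff_forall_notMem]
      rintro n ⟨w, -, -, -, hlt⟩
      have hf := p.mem_feasible_of_J_le hx hlt.le
      rw [p.J_lt_iff_gap_lt hf hx] at hlt
      linarith [gap_nonneg hf]
    simp [this]
  · obtain ⟨z, hz, hz0⟩ := p.exists_gap_eq_zero hx
    have hzx : p.J z < p.J x := by rwa [p.J_lt_iff_gap_lt hz hx, hz0]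
    obtain ⟨n, w, ⟨hw0, hwn, hw⟩, hJ⟩ := p.exists_isPath_J_le hm hx hzx.le
    have hne : (L x).Nonempty := ⟨n, w, hw0, hw, hJ, by rwa [hwn]⟩
    obtain ⟨w, hw0, hw, hJ, hlt⟩ := Nat.sInf_mem hne
    have hn : 0 < sInf (L x) := by
      rw [Nat.pos_iff_ne_zero]
      intro h
      rw [h, hw0] at hlt
      exact lt_irrefl _ hlt
    have hJ1 := hJ 1 hn
    have hf := p.mem_feasible_of_J_le hx hJ1
    refine ⟨hn, w 1, hf, by simpa [hw0] using hw 0 hn, ?_⟩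
    rcases hJ1.lt_or_eq with h | h
    · exact Or.inl ((p.J_lt_iff_gap_lt hf hx).1 h)
    · refine Or.inr ⟨by rw [gap, gap, h], ?_⟩
      -- If the first move of a shortest path is flat, the rest of the path is admissible for `w 1`.
      have : sInf (L x) - 1 ∈ L (w 1) := by
        refine ⟨fun i => w (i + 1), rfl, fun i hi => hw (i + 1) (by omega),
          fun i hi => by rw [h]; exact hJ (i + 1) (by omega), ?_⟩
        change p.J (w (sInf (L x) - 1 + 1)) < p.J (w 1)
        rwa [h, Nat.sub_add_cancel (show 1 ≤ sInf (L x) from hn)]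
      exact (Nat.sInf_le this).trans_lt (Nat.sub_lt hn one_pos)

/-! ### The Lyapunov function and its drift. -/

/-- The Lyapunov function: an exponential of the gap, corrected by a rank `D`. -/
def lyapunov (D : E → ℕ) (ρ s : ℝ) (x : E) : ℝ :=
  (2 - ρ ^ D x) * Real.exp (3 / 4 * s * p.gap x)

lemma exists_q0_lower : ∃ q : ℝ, 0 < q ∧ ∀ x y, y ∈ p.S x → q ≤ p.q0 x y := by
  classical
  by_cases h : (Finset.univ.filter fun z : E × E => z.2 ∈ p.S z.1).Nonempty
  · obtain ⟨z, hz, hmin⟩ := Finset.exists_min_image _ (fun z : E × E => p.q0 z.1 z.2) h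
    exact ⟨p.q0 z.1 z.2, (p.q0_support _ _).2 (by simpa using hz),
      fun x y hxy => hmin (x, y) (by simpa using hxy)⟩
  · refine ⟨1, one_pos, fun x y hxy => absurd ⟨(x, y), by simpa using hxy⟩ h⟩

lemma lyapunov_bounds {D : E → ℕ} {ρ : ℝ} (h0 : 0 ≤ ρ) (h1 : ρ ≤ 1) (s : ℝ) (x : E) :
    Real.exp (3 / 4 * s * p.gap x) ≤ p.lyapunov D ρ s x ∧
      p.lyapunov D ρ s x ≤ 2 * Real.exp (3 / 4 * s * p.gap x) := by
  have h2 : ρ ^ D x ≤ 1 := pow_le_one₀ h0 h1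
  have h3 : 0 ≤ ρ ^ D x := pow_nonneg h0 _
  have h4 := Real.exp_pos (3 / 4 * s * p.gap x)
  rw [lyapunov]
  constructor <;> nlinarith

/-- At a point which is not optimal, the Lyapunov function decreases at a fixed rate, once moves
uphill are rare. -/
lemma sum_lyapunov_le {D : E → ℕ} {q a η ρ s : ℝ} (hq : 0 < q)
    (hq0 : ∀ x y, y ∈ p.S x → q ≤ p.q0 x y) (ha : 0 < a) (hqa : q * a ≤ 1)
    (hρ : ρ = q * a / 4) {x y₀ : E} (hDx : 0 < D x) (hy₀ : y₀ ∈ p.S x)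
    (hy₀D : p.gap y₀ < p.gap x ∨ p.gap y₀ = p.gap x ∧ D y₀ < D x) {A : E → ℝ}
    (hA0 : ∀ y, 0 ≤ A y) (hA1 : ∀ y, A y ≤ 1) (hAS : ∀ y ∉ p.feasible, A y = 0) (hη : 0 ≤ η)
    (hup : ∀ y ∈ p.feasible, p.gap x < p.gap y →
      A y * (2 * Real.exp (3 / 4 * s * (p.gap y - p.gap x))) ≤ η)
    (hdown : ∀ y, p.gap y < p.gap x → 2 * Real.exp (3 / 4 * s * (p.gap y - p.gap x)) ≤ 1 / 2)
    (haA : a ≤ A y₀) :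
    ∑ y, p.q0 x y * (A y * (p.lyapunov D ρ s y - p.lyapunov D ρ s x))
      ≤ (η - q * a * ρ ^ (D x - 1) / 4) * Real.exp (3 / 4 * s * p.gap x) := by
  set V := Real.exp (3 / 4 * s * p.gap x) with hV
  have hV0 : 0 < V := Real.exp_pos _
  have hρ0 : 0 < ρ := by rw [hρ]; positivity
  have hρ1 : ρ ≤ 1 / 4 := by rw [hρ]; linarith
  have hρD : ρ ^ D x = q * a / 4 * ρ ^ (D x - 1) := by
    nth_rw 1 [← Nat.sub_add_cancel hDx, pow_succ, mul_comm]
    rw [← hρ]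
  have hpow : ∀ n : ℕ, 0 < ρ ^ n := fun n => pow_pos hρ0 n
  have hxV : V ≤ p.lyapunov D ρ s x := (p.lyapunov_bounds hρ0.le (by linarith) s x).1
  have hyV : ∀ y, p.lyapunov D ρ s y ≤ 2 * Real.exp (3 / 4 * s * (p.gap y - p.gap x)) * V := by
    intro y
    refine (p.lyapunov_bounds hρ0.le (by linarith) s y).2.trans (le_of_eq ?_)
    rw [mul_assoc 2 (Real.exp _) V, hV, ← Real.exp_add]
    ring_nf
  have hflat : ∀ y, p.gap y = p.gap x →
      p.lyapunov D ρ s y - p.lyapunov D ρ s x = (ρ ^ D x - ρ ^ D y) * V := by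
    intro y hy
    rw [lyapunov, lyapunov, hy]
    ring
  -- The worst increase over all moves: a downhill move does not increase the function, a flat one
  -- adds at most ρ^(D x) V, and an uphill one at most η V.
  have hall : ∀ y, A y * (p.lyapunov D ρ s y - p.lyapunov D ρ s x) ≤ (η + ρ ^ D x) * V := by
    intro y
    have hr : 0 ≤ (η + ρ ^ D x) * V := by
      have := hpow (D x)
      positivity
    by_cases hy : y ∈ p.feasible
    swap
    · simpa [hAS y hy] using hr
    rcases lt_trichotomy (p.gap y) (p.gap x) with h | h | h
    · refine (mul_nonpos_of_nonneg_of_nonpos (hA0 y) ?_).trans hr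
      nlinarith [hyV y, hdown y h]
    · rw [hflat y h]
      have h1 : (ρ ^ D x - ρ ^ D y) * V ≤ (η + ρ ^ D x) * V :=
        mul_le_mul_of_nonneg_right (by linarith [hpow (D y)]) hV0.le
      nlinarith [hA0 y, hA1 y]
    · have h1 : A y * (p.lyapunov D ρ s y - p.lyapunov D ρ s x)
          ≤ A y * (2 * Real.exp (3 / 4 * s * (p.gap y - p.gap x)) * V) :=
        mul_le_mul_of_nonneg_left (by linarith [hyV y]) (hA0 y)
      have h2 := mul_le_mul_of_nonneg_right (hup y hy h) hV0.le
      nlinarith [hpow (D x)]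
  -- The move to `y₀` gains a multiple of ρ^(D x - 1). With probability at least qa, it outweighs
  -- the possible flat loss ρ^(D x) = (qa/4) ρ^(D x - 1).
  have hgood : p.lyapunov D ρ s y₀ - p.lyapunov D ρ s x ≤ -(ρ ^ (D x - 1) / 2 * V) := by
    rcases hy₀D with h | ⟨h, hD⟩
    · have h1 : ρ ^ (D x - 1) ≤ 1 := pow_le_one₀ hρ0.le (by linarith)
      nlinarith [hyV y₀, hdown y₀ h]
    · rw [hflat y₀ h]
      have h1 : ρ ^ (D x - 1) ≤ ρ ^ D y₀ := pow_le_pow_of_le_one hρ0.le (by linarith) (by omega)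
      have h2 : ρ ^ D x ≤ ρ ^ (D x - 1) / 4 := by
        rw [hρD]
        nlinarith [hpow (D x - 1)]
      nlinarith [hpow (D x - 1)]
  have hterm : ∀ y, p.q0 x y * (A y * (p.lyapunov D ρ s y - p.lyapunov D ρ s x))
      ≤ p.q0 x y * ((η + ρ ^ D x) * V)
        + if y = y₀ then -(q * a * (ρ ^ (D x - 1) / 2 * V)) else 0 := by
    intro y
    split_ifs with h
    · subst h
      have h1 : q * a ≤ p.q0 x y * A y :=
        mul_le_mul (hq0 x y hy₀) haA ha.le (p.q0_nonneg x y)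
      have h2 : 0 ≤ p.q0 x y * ((η + ρ ^ D x) * V) :=
        mul_nonneg (p.q0_nonneg x y) (by have := hpow (D x); positivity)
      have h3 : 0 ≤ ρ ^ (D x - 1) / 2 * V := by have := hpow (D x - 1); positivity
      have h4 : p.q0 x y * A y * (p.lyapunov D ρ s y - p.lyapunov D ρ s x)
          ≤ p.q0 x y * A y * -(ρ ^ (D x - 1) / 2 * V) :=
        mul_le_mul_of_nonneg_left hgood (mul_nonneg (p.q0_nonneg x y) (hA0 y))
      have h5 := mul_le_mul_of_nonneg_right h1 h3
      linarith
    · rw [add_zero]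
      exact mul_le_mul_of_nonneg_left (hall y) (p.q0_nonneg x y)
  refine (Finset.sum_le_sum fun y _ => hterm y).trans (le_of_eq ?_)
  rw [Finset.sum_add_distrib, ← Finset.sum_mul, p.q0_sum, Finset.sum_ite_eq' Finset.univ y₀,
    if_pos (Finset.mem_univ _), hρD]
  ring

/-- The drift inequality for the Lyapunov function. -/
lemma exists_drift (hm : p.mStar = 0) {a : ℝ} (ha : 0 < a) (ha1 : a ≤ 1) :
    ∃ (D : E → ℕ) (ρ c : ℝ), 0 < ρ ∧ ρ ≤ 1 ∧ 0 < c ∧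
      ∀ (β β' : ℝ → ℝ) (A : ℝ → E → E → ℝ),
      (∀ r x y, 0 ≤ A r x y) → (∀ r x y, A r x y ≤ 1) →
      (∀ r, ∀ x ∈ p.feasible, ∀ y ∉ p.feasible, A r x y = 0) →
      (∀ r, ∀ x ∈ p.feasible, ∀ y ∈ p.feasible, p.gap y ≤ p.gap x → 0 ≤ r → a ≤ A r x y) →
      (∀ x ∈ p.feasible, ∀ y ∈ p.feasible, p.gap x < p.gap y → Filter.Tendsto
        (fun r => A r x y * Real.exp (3 / 4 * β r * (p.gap y - p.gap x))) Filter.atTop (nhds 0)) →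
      Filter.Tendsto β Filter.atTop Filter.atTop → MonotoneOn β (Set.Ici 0) →
      (∃ B, ∀ r, 0 ≤ r → β' r ≤ B) → (∀ r, 0 ≤ r → 0 ≤ β' r) →
      (∀ᶠ r in Filter.atTop, β' r ≤ c) →
      ∃ k K : ℝ, 0 < k ∧ 0 ≤ K ∧ ∀ r, 0 ≤ r → ∀ x ∈ p.feasible,
        3 / 4 * β' r * p.gap x * p.lyapunov D ρ (β r) x
          + ∑ y, p.q0 x y * (A r x y * (p.lyapunov D ρ (β r) y - p.lyapunov D ρ (β r) x))
          + k * p.lyapunov D ρ (β r) x ≤ k * K := by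
  obtain ⟨D, hD⟩ := p.exists_rank hm
  obtain ⟨q', hq', hq0'⟩ := p.exists_q0_lower
  obtain ⟨q, hq, hq1, hq0⟩ : ∃ q : ℝ, 0 < q ∧ q ≤ 1 ∧ ∀ x y, y ∈ p.S x → q ≤ p.q0 x y :=
    ⟨min q' 1, lt_min hq' one_pos, min_le_right _ _,
      fun x y h => (min_le_left _ _).trans (hq0' x y h)⟩
  have hqa : q * a ≤ 1 := mul_le_one₀ hq1 ha.le ha1
  set ρ := q * a / 4 with hρ
  have hρ0 : 0 < ρ := by positivity
  have hρ1 : ρ ≤ 1 := by linarith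
  set R := Finset.univ.sup D
  -- Half of the smallest value of qaρ^(D x - 1)/4 guaranteed by the maximal rank. With η = l, the
  -- net drift is at most -l V.
  set l := q * a * ρ ^ R / 8 with hl
  have hl0 : 0 < l := by positivity
  have hM : (0 : ℝ) < p.M := p.M_pos
  -- With this bound on β' the growth of β costs at most (3/8) l V, and k = l/4 costs at most l V/2;
  -- their sum stays below l V.
  refine ⟨D, ρ, l / (4 * p.M), hρ0, hρ1, by positivity, ?_⟩
  intro β β' A hA0 hA1 hAS hlow hup hβ hβm hB' hβ'0 hβ'
  have hev : ∀ᶠ r in Filter.atTop, (0 : ℝ) ≤ r ∧ β' r ≤ l / (4 * p.M) ∧ (∀ x ∈ p.feasible,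
      ∀ y ∈ p.feasible, p.gap x < p.gap y →
        A r x y * (2 * Real.exp (3 / 4 * β r * (p.gap y - p.gap x))) ≤ l) ∧
      (∀ x y, p.gap y < p.gap x →
        2 * Real.exp (3 / 4 * β r * (p.gap y - p.gap x)) ≤ 1 / 2) := by
    refine (Filter.eventually_ge_atTop 0).and (hβ'.and (Filter.Eventually.and ?_ ?_))
    · simp only [Filter.eventually_all]
      intro x hx y hy hxy
      filter_upwards [(hup x hx y hy hxy).eventually (gt_mem_nhds (half_pos hl0))] with r hr
      linarith
    · simp only [Filter.eventually_all]
      intro x y hxy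
      have h1 : Filter.Tendsto (fun r => Real.exp (3 / 4 * β r * (p.gap y - p.gap x)))
          Filter.atTop (nhds 0) := by
        refine Real.tendsto_exp_atBot.comp ?_
        refine Filter.Tendsto.atTop_mul_const_of_neg (sub_neg.2 hxy) ?_
        exact Filter.Tendsto.const_mul_atTop (by norm_num) hβ
      filter_upwards [h1.eventually (gt_mem_nhds (by norm_num : (0 : ℝ) < 1 / 4))] with r hr
      linarith
  obtain ⟨t₀, ht₀⟩ := Filter.eventually_atTop.1 hev
  obtain ⟨B', hB'⟩ := hB'
  set X := 2 * Real.exp (3 / 4 * max (β (max t₀ 0)) 0 * p.M) with hX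
  have hX0 : 0 < X := by positivity
  set k := l / 4 with hk
  have hk0 : 0 < k := by positivity
  have hB0 : 0 ≤ B' := (hβ'0 0 le_rfl).trans (hB' 0 le_rfl)
  -- At late times only the minima need a constant: the sum is at most l = 4k and the function
  -- equals 1, hence 5k. The other entry covers the times before `t₀`, where the function is at most
  -- `X`.
  refine ⟨k, max 5 ((3 / 4 * B' * p.M * X + X + k * X) / k), hk0,
    (by norm_num : (0 : ℝ) ≤ 5).trans (le_max_left _ _), fun r hr x hx => ?_⟩
  have hgx := gap_nonneg hx
  have hgM := gap_le hx
  have hWx := p.lyapunov_bounds (D := D) hρ0.le hρ1 (β r) x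
  have hW0 : ∀ y, 0 ≤ p.lyapunov D ρ (β r) y := fun y =>
    (Real.exp_nonneg _).trans (p.lyapunov_bounds (D := D) hρ0.le hρ1 (β r) y).1
  rcases lt_or_ge r t₀ with hrt | hrt
  · have hWX : ∀ y ∈ p.feasible, p.lyapunov D ρ (β r) y ≤ X := by
      intro y hy
      refine (p.lyapunov_bounds (D := D) hρ0.le hρ1 (β r) y).2.trans ?_
      rw [hX]
      have h1 : β r ≤ max (β (max t₀ 0)) 0 :=
        (hβm hr (le_max_right t₀ 0) (hrt.le.trans (le_max_left _ _))).trans (le_max_left _ _)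
      have h2 := gap_nonneg hy
      have h3 := gap_le hy
      gcongr
    have hsum : ∑ y, p.q0 x y * (A r x y * (p.lyapunov D ρ (β r) y - p.lyapunov D ρ (β r) x))
        ≤ X := by
      calc _ ≤ ∑ y, p.q0 x y * X := by
            refine Finset.sum_le_sum fun y _ => mul_le_mul_of_nonneg_left ?_ (p.q0_nonneg x y)
            by_cases hy : y ∈ p.feasible
            · have h1 : p.lyapunov D ρ (β r) y - p.lyapunov D ρ (β r) x ≤ X := by
                linarith [hWX y hy, hW0 x]
              nlinarith [hA0 r x y, hA1 r x y]
            · simpa [hAS r x hx y hy] using hX0.le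
        _ = X := by rw [← Finset.sum_mul, p.q0_sum, one_mul]
    have h1 : 3 / 4 * β' r * p.gap x * p.lyapunov D ρ (β r) x ≤ 3 / 4 * B' * p.M * X := by
      have := hB' r hr
      have := hβ'0 r hr
      have := hWX x hx
      have := hW0 x
      gcongr
    have h2 : k * p.lyapunov D ρ (β r) x ≤ k * X := mul_le_mul_of_nonneg_left (hWX x hx) hk0.le
    have h3 : (3 / 4 * B' * p.M * X + X + k * X) / k * k ≤
        max 5 ((3 / 4 * B' * p.M * X + X + k * X) / k) * k :=
      mul_le_mul_of_nonneg_right (le_max_right _ _) hk0.le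
    rw [div_mul_cancel₀ _ hk0.ne'] at h3
    linarith
  · obtain ⟨-, hβ'r, hupr, hdownr⟩ := ht₀ r hrt
    have h5 : k * 5 ≤ k * max 5 ((3 / 4 * B' * p.M * X + X + k * X) / k) :=
      mul_le_mul_of_nonneg_left (le_max_left _ _) hk0.le
    refine le_trans ?_ h5
    rcases hgx.eq_or_lt with h0 | hpos
    · have hD0 := (hD x hx).1 h0.symm
      have hWx1 : p.lyapunov D ρ (β r) x = 1 := by
        simp only [lyapunov, ← h0, hD0, pow_zero, mul_zero, Real.exp_zero]
        norm_num
      have hsum : ∑ y, p.q0 x y * (A r x y * (p.lyapunov D ρ (β r) y - p.lyapunov D ρ (β r) x))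
          ≤ l := by
        calc _ ≤ ∑ y, p.q0 x y * l := by
              refine Finset.sum_le_sum fun y _ => mul_le_mul_of_nonneg_left ?_ (p.q0_nonneg x y)
              by_cases hy : y ∈ p.feasible
              · rcases (gap_nonneg hy).eq_or_lt with hy0 | hy0
                · have : p.lyapunov D ρ (β r) y = 1 := by
                    simp only [lyapunov, ← hy0, (hD y hy).1 hy0.symm, pow_zero, mul_zero,
                      Real.exp_zero]
                    norm_num
                  rw [this, hWx1, sub_self, mul_zero]
                  exact hl0.le
                · refine le_trans ?_ (hupr x hx y hy (h0 ▸ hy0))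
                  refine mul_le_mul_of_nonneg_left ?_ (hA0 r x y)
                  rw [← h0, sub_zero]
                  linarith [(p.lyapunov_bounds (D := D) hρ0.le hρ1 (β r) y).2, hW0 x]
              · simpa [hAS r x hx y hy] using hl0.le
          _ = l := by rw [← Finset.sum_mul, p.q0_sum, one_mul]
      rw [hWx1] at hsum ⊢
      rw [← h0]
      linarith
    · obtain ⟨hDx, y₀, hy₀, hyS, hyD⟩ := (hD x hx).2 hpos
      have hy₀le : p.gap y₀ ≤ p.gap x := hyD.elim le_of_lt fun h => h.1.le
      have hsum := p.sum_lyapunov_le (D := D) (s := β r) hq hq0 ha hqa hρ hDx hyS hyD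
        (hA0 r x) (hA1 r x) (hAS r x hx) hl0.le (hupr x hx) (hdownr x)
        (hlow r x hx y₀ hy₀ hy₀le hr)
      have hpw : ρ ^ R ≤ ρ ^ (D x - 1) :=
        pow_le_pow_of_le_one hρ0.le hρ1
          ((Nat.sub_le _ _).trans (Finset.le_sup (f := D) (Finset.mem_univ x)))
      set V := Real.exp (3 / 4 * β r * p.gap x)
      have hV0 : 0 < V := Real.exp_pos _
      have h1 : (l - q * a * ρ ^ (D x - 1) / 4) * V ≤ -l * V := by
        refine mul_le_mul_of_nonneg_right ?_ hV0.le
        have : q * a * ρ ^ R ≤ q * a * ρ ^ (D x - 1) :=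
          mul_le_mul_of_nonneg_left hpw (by positivity)
        rw [hl]
        linarith
      have h2 : 3 / 4 * β' r * p.gap x * p.lyapunov D ρ (β r) x
          ≤ 3 / 4 * (l / (4 * p.M)) * p.M * (2 * V) := by
        have := hβ'0 r hr
        have := hW0 x
        have := hWx.2
        gcongr
      have h3 : 3 / 4 * (l / (4 * p.M)) * p.M * (2 * V) = 3 / 8 * l * V := by
        field_simp
        norm_num
      have h4 : k * p.lyapunov D ρ (β r) x ≤ k * (2 * V) :=
        mul_le_mul_of_nonneg_left hWx.2 hk0.le
      have h6 : k * (2 * V) = l * V / 2 := by rw [hk]; ring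
      have h7 : 0 < l * V := by positivity
      linarith

end NSASetting

/-! ### The polynomial schedule and the exponential moment. -/

lemma polySchedule_β_toNNReal (d : ℝ≥0) (b : ℝ) {r : ℝ} (hr : 0 ≤ r) :
    ((polySchedule d b).β r.toNNReal : ℝ) = d * (1 + r) ^ b := by
  simp [polySchedule, Real.coe_toNNReal r hr]

lemma polySchedule_n_toNNReal (d : ℝ≥0) (b : ℝ) {r : ℝ} (hr : 0 ≤ r) :
    ((polySchedule d b).n r.toNNReal : ℝ) = (1 + r) ^ 2 := by
  simp [polySchedule, Real.coe_toNNReal r hr]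

lemma hasDerivAt_polySchedule (d b : ℝ) {r : ℝ} (hr : 0 ≤ r) :
    HasDerivAt (fun r : ℝ => d * (1 + r) ^ b) (d * (b * (1 + r) ^ (b - 1))) r := by
  have h1 : HasDerivAt (fun r : ℝ => 1 + r) 1 r := (hasDerivAt_id r).const_add 1
  have h := (h1.rpow_const (p := b) (Or.inl (by positivity))).const_mul d
  refine h.congr_deriv ?_
  ring

namespace NSASetting

variable {E Ω : Type*} [Fintype E] [DecidableEq E] [MeasurableSpace Ω] (p : NSASetting E Ω)

lemma gap_sub_gap (x y : E) : p.gap y - p.gap x = (p.J y).toReal - (p.J x).toReal := by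
  rw [gap, gap]
  ring

lemma exists_gap_lower : ∃ Δ : ℝ, 0 < Δ ∧ ∀ x, 0 < p.gap x → Δ ≤ p.gap x := by
  by_cases h : (Finset.univ.filter fun x => 0 < p.gap x).Nonempty
  · obtain ⟨z, hz, hmin⟩ := Finset.exists_min_image _ p.gap h
    exact ⟨p.gap z, by simpa using hz, fun x hx => hmin x (by simpa using hx)⟩
  · exact ⟨1, one_pos, fun x hx => absurd ⟨x, by simpa using hx⟩ h⟩

/-- The level 7/8 lies strictly between the Lyapunov exponent 3/4 and 1: exp(-(7/8) βΔ) beats the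
growth exp((3/4) βΔ), and the large deviation term exp(-κ(1 + r)²) beats it because β ≤ d(1 + r). -/
lemma tendsto_meanAccept_mul_exp (d : ℝ≥0) {b : ℝ} (hd : 0 < d) (hb0 : 0 < b) (hb1 : b ≤ 1)
    {x y : E} (hx : x ∈ p.feasible) (hy : y ∈ p.feasible) (hxy : p.gap x < p.gap y) :
    Filter.Tendsto (fun r : ℝ => (p.meanAccept (polySchedule d b) r.toNNReal x y).toReal
      * Real.exp (3 / 4 * (d * (1 + r) ^ b) * (p.gap y - p.gap x))) Filter.atTop (nhds 0) := by
  set Δ := p.gap y - p.gap x with hΔ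
  have hΔ0 : 0 < Δ := sub_pos.2 hxy
  obtain ⟨κ, hκ, hle⟩ := p.exists_meanAccept_le hx hy (a := 7 / 8 * Δ)
    (by rw [← p.gap_sub_gap, ← hΔ]; linarith)
  have hd' : (0 : ℝ) < d := hd
  have hu : Filter.Tendsto (fun r : ℝ => 1 + r) Filter.atTop Filter.atTop :=
    Filter.tendsto_atTop_add_const_left _ _ Filter.tendsto_id
  have h1 : Filter.Tendsto (fun r : ℝ => Real.exp (-(Δ / 8 * d * (1 + r) ^ b)))
      Filter.atTop (nhds 0) := by
    refine Real.tendsto_exp_neg_atTop_nhds_zero.comp ?_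
    exact Filter.Tendsto.const_mul_atTop (by positivity) ((tendsto_rpow_atTop hb0).comp hu)
  have h2 : Filter.Tendsto (fun r : ℝ => Real.exp (-((1 + r) * (κ * (1 + r) - d * Δ))))
      Filter.atTop (nhds 0) := by
    refine Real.tendsto_exp_neg_atTop_nhds_zero.comp (hu.atTop_mul_atTop₀ ?_)
    exact Filter.tendsto_atTop_add_const_right _ _ (Filter.Tendsto.const_mul_atTop hκ hu)
  have h3 := h1.add h2
  rw [add_zero] at h3
  refine squeeze_zero' (Filter.Eventually.of_forall fun r =>
    mul_nonneg ENNReal.toReal_nonneg (Real.exp_nonneg _)) ?_ h3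
  filter_upwards [Filter.eventually_ge_atTop (0 : ℝ)] with r hr
  have hA := hle (polySchedule d b) r.toNNReal
  rw [polySchedule_β_toNNReal d b hr, polySchedule_n_toNNReal d b hr] at hA
  have hpow : (1 + r) ^ b ≤ 1 + r := by
    simpa using Real.rpow_le_rpow_of_exponent_le (by linarith : (1 : ℝ) ≤ 1 + r) hb1
  have hpow0 : 0 ≤ (1 + r) ^ b := by positivity
  calc _ ≤ (Real.exp (-(d * (1 + r) ^ b * (7 / 8 * Δ))) + Real.exp (-(κ * (1 + r) ^ 2)))
        * Real.exp (3 / 4 * (d * (1 + r) ^ b) * Δ) :=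
        mul_le_mul_of_nonneg_right hA (Real.exp_nonneg _)
    _ ≤ _ := by
        rw [add_mul, ← Real.exp_add, ← Real.exp_add]
        have hdΔ : 0 < d * Δ := mul_pos hd' hΔ0
        refine add_le_add (Real.exp_le_exp.2 (le_of_eq ?_)) (Real.exp_le_exp.2 ?_)
        · ring
        · nlinarith [mul_le_mul_of_nonneg_left hpow hdΔ.le, mul_nonneg hdΔ.le hpow0]

lemma exp_le_meanAccept_polySchedule (d : ℝ≥0) {b : ℝ} (hb1 : b ≤ 1) {x y : E}
    (hx : x ∈ p.feasible) (hy : y ∈ p.feasible) (hxy : p.gap y ≤ p.gap x) {r : ℝ} (hr : 0 ≤ r) :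
    Real.exp (-(d * ((p.M ^ 2 + 1) / 2)))
      ≤ (p.meanAccept (polySchedule d b) r.toNNReal x y).toReal := by
  have hn : 0 < (polySchedule d b).n r.toNNReal := by simp [polySchedule]
  refine le_trans ?_ (p.exp_le_meanAccept _ _ hn hx hy
    (by linarith [p.gap_sub_gap x y]))
  rw [polySchedule_β_toNNReal d b hr, polySchedule_n_toNNReal d b hr,
    Real.sqrt_sq (by positivity), Real.exp_le_exp, neg_le_neg_iff, div_le_iff₀ (by positivity)]
  have hpow : (1 + r) ^ b ≤ 1 + r := by
    simpa using Real.rpow_le_rpow_of_exponent_le (by linarith : (1 : ℝ) ≤ 1 + r) hb1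
  calc (d : ℝ) * (1 + r) ^ b * ((p.M ^ 2 + 1) / 2)
      = d * ((p.M ^ 2 + 1) / 2) * (1 + r) ^ b := by ring
    _ ≤ _ := by gcongr

variable [MeasurableSpace E] [MeasurableSingletonClass E]

/-- The exponential moments of the gap stay bounded along the process. -/
lemma exists_lintegral_exp_gap_le (hm : p.mStar = 0) (d₁ : ℝ≥0) :
    ∃ c : ℝ, 0 < c ∧ ∀ (d : ℝ≥0) (b : ℝ), 0 < d → d ≤ d₁ → 0 < b → b ≤ 1 → (b = 1 → d ≤ c) →
      ∃ K : ℝ, 0 < K ∧ ∀ (ν : Measure E) [IsProbabilityMeasure ν] (T : ℝ≥0)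
        [DecidablePred (· ∈ p.feasible)], ν p.feasibleᶜ = 0 →
        ∫⁻ h, ∑' k : ℕ, (if (h k).2.1 ≤ T ∧ T < (h (k + 1)).2.1 then
          (if (h k).1 ∈ p.feasible then
            ENNReal.ofReal (Real.exp (3 / 4 * (d * (1 + T) ^ b) * p.gap (h k).1)) else ∞) else 0)
          ∂(p.law (polySchedule d b) ν) ≤ ENNReal.ofReal K := by
  -- The acceptance bound uses `d₁` rather than `d`, so that `c` does not depend on `d`.
  obtain ⟨D, ρ, c, hρ0, hρ1, hc, hdrift⟩ := p.exists_drift hm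
    (a := Real.exp (-(d₁ * ((p.M ^ 2 + 1) / 2)))) (Real.exp_pos _)
    (Real.exp_le_one_iff.2 (neg_nonpos.2 (by positivity)))
  refine ⟨c, hc, fun d b hd hdd₁ hb0 hb1 hbc => ?_⟩
  have hd' : (0 : ℝ) < d := hd
  set σ := polySchedule d b
  set β : ℝ → ℝ := fun r => d * (1 + r) ^ b
  set β' : ℝ → ℝ := fun r => d * (b * (1 + r) ^ (b - 1))
  have hu : Filter.Tendsto (fun r : ℝ => 1 + r) Filter.atTop Filter.atTop :=
    Filter.tendsto_atTop_add_const_left _ _ Filter.tendsto_id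
  have hβ'c : ContinuousOn β' (Set.Ici 0) := by
    have h1 : ContinuousOn (fun r : ℝ => (1 + r) ^ (b - 1)) (Set.Ici 0) :=
      ContinuousOn.rpow_const (by fun_prop) fun r hr => Or.inl (by
        have : (0 : ℝ) ≤ r := hr
        positivity)
    fun_prop
  obtain ⟨k, K, hk, hK, hkK⟩ := hdrift β β'
    (fun r x y => (p.meanAccept σ r.toNNReal x y).toReal) (fun _ _ _ => ENNReal.toReal_nonneg)
    (fun r x y => ENNReal.toReal_le_of_le_ofReal zero_le_one
      (by simpa using p.meanAccept_le_one σ r.toNNReal x y))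
    (fun r x hx y hy => by simp [p.meanAccept_eq_zero σ r.toNNReal hx hy])
    (fun r x hx y hy hxy hr => by
      refine le_trans (Real.exp_le_exp.2 (neg_le_neg ?_))
        (p.exp_le_meanAccept_polySchedule d hb1 hx hy hxy hr)
      gcongr)
    (fun x hx y hy hxy => p.tendsto_meanAccept_mul_exp d hd hb0 hb1 hx hy hxy)
    (Filter.Tendsto.const_mul_atTop hd' ((tendsto_rpow_atTop hb0).comp hu))
    (fun r hr s hs hrs => by
      have : (0 : ℝ) ≤ r := hr
      change (d : ℝ) * (1 + r) ^ b ≤ d * (1 + s) ^ b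
      gcongr)
    ⟨d * (b * 1), fun r hr => by
      have : (1 + r) ^ (b - 1) ≤ 1 :=
        Real.rpow_le_one_of_one_le_of_nonpos (by linarith) (by linarith)
      change (d : ℝ) * (b * (1 + r) ^ (b - 1)) ≤ d * (b * 1)
      gcongr⟩
    (fun r hr => by change 0 ≤ (d : ℝ) * (b * (1 + r) ^ (b - 1)); positivity)
    -- For b < 1 the derivative of β tends to 0; for b = 1 it is the constant `d`.
    (by
      rcases hb1.lt_or_eq with hb | rfl
      · have h1 : Filter.Tendsto (fun r : ℝ => (1 + r) ^ (b - 1)) Filter.atTop (nhds 0) := by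
          have := (tendsto_rpow_neg_atTop (sub_pos.2 hb)).comp hu
          simpa [Function.comp_def] using this
        have h2 : Filter.Tendsto β' Filter.atTop (nhds 0) := by
          simpa using (h1.const_mul b).const_mul (d : ℝ)
        exact (h2.eventually (gt_mem_nhds hc)).mono fun r hr => hr.le
      · refine Filter.Eventually.of_forall fun r => ?_
        simpa [β'] using hbc rfl)
  refine ⟨2 * Real.exp (3 / 4 * d * p.M) + K, by positivity, fun ν _ T _ hν => ?_⟩
  set e : ℝ → ℝ := fun r => Real.exp (k * (r - T))
  have he : ∀ r, HasDerivAt e (e r * k) r := by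
    intro r
    have h1 : HasDerivAt (fun r : ℝ => k * (r - T)) (k * 1) r :=
      ((hasDerivAt_id r).sub_const _).const_mul k
    simpa using h1.exp
  have hec : Continuous e := by fun_prop
  set W : ℝ → E → ℝ := fun r x => p.lyapunov D ρ (β r) x
  have hW0 : ∀ r x, 0 ≤ W r x := fun r x =>
    (Real.exp_nonneg _).trans (p.lyapunov_bounds (D := D) hρ0.le hρ1 (β r) x).1
  set W' : ℝ → E → ℝ := fun r x => 3 / 4 * β' r * p.gap x * W r x
  have hW : ∀ x r, 0 ≤ r → HasDerivAt (fun r => W r x) (W' r x) r := by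
    intro x r hr
    have h1 := ((((hasDerivAt_polySchedule d b hr).const_mul (3 / 4)).mul_const
      (p.gap x)).exp).const_mul (2 - ρ ^ D x)
    refine h1.congr_deriv ?_
    simp only [W', W, β', β, lyapunov]
    ring
  have hWc : ∀ x, ContinuousOn (fun r => W r x) (Set.Ici 0) := fun x r hr =>
    (hW x r hr).continuousAt.continuousWithinAt
  -- The drift inequality W' + LW + kW ≤ kK, with L the generator, makes e W + K(1 - e) a
  -- supersolution. It equals `W` at time `T`, and at time 0 it is at most W + K.
  have hmain := p.lintegral_terminal_le σ ν T p.feasible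
    (fun t x hx y hy => p.meanAccept_eq_zero σ t hx hy)
    (Φ := fun r x => e r * W r x + K * (1 - e r))
    (Φ' := fun r x => (e r * k * W r x + e r * W' r x) + K * -(e r * k))
    (fun x => by
      simp only [e, W, β, lyapunov]
      fun_prop)
    (fun x _ r hr => ((he r).mul (hW x r hr.1)).add (((he r).const_sub 1).const_mul K))
    (fun x _ => by
      have h1 := (hWc x).mono (Set.Icc_subset_Ici_self : Set.Icc (0 : ℝ) T ⊆ _)
      have h2 := hβ'c.mono (Set.Icc_subset_Ici_self : Set.Icc (0 : ℝ) T ⊆ _)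
      simp only [W']
      fun_prop)
    (fun x _ r hr => by
      have h1 : e r ≤ 1 := Real.exp_le_one_iff.2
        (mul_nonpos_of_nonneg_of_nonpos hk.le (sub_nonpos.2 hr.2))
      have h2 : 0 ≤ K * (1 - e r) := mul_nonneg hK (sub_nonneg.2 h1)
      have h3 : 0 ≤ e r * W r x := mul_nonneg (Real.exp_nonneg _) (hW0 r x)
      linarith)
    (fun x hx r hr => by
      have h1 := hkK r hr.1 x hx
      have h2 : ∑ y, p.q0 x y * ((p.meanAccept σ r.toNNReal x y).toReal *
          ((e r * W r y + K * (1 - e r)) - (e r * W r x + K * (1 - e r))))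
          = e r * ∑ y, p.q0 x y * ((p.meanAccept σ r.toNNReal x y).toReal *
            (W r y - W r x)) := by
        rw [Finset.mul_sum]
        exact Finset.sum_congr rfl fun y _ => by ring
      rw [h2]
      have h3 := mul_le_mul_of_nonneg_left h1 (Real.exp_nonneg (k * (r - T)))
      change e r * (W' r x + ∑ y, p.q0 x y * ((p.meanAccept σ r.toNNReal x y).toReal *
            (W r y - W r x)) + k * W r x) ≤ e r * (k * K) at h3
      linarith)
  refine le_trans (lintegral_mono fun h => ENNReal.tsum_le_tsum fun i => ?_) (hmain.trans ?_)
  · split_ifs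
    · refine ENNReal.ofReal_le_ofReal ?_
      have : e T = 1 := by simp [e]
      simp only [this, one_mul, sub_self, mul_zero, add_zero]
      exact (p.lyapunov_bounds (D := D) hρ0.le hρ1 (β T) (h i).1).1
    · exact le_rfl
    · exact le_rfl
  · calc _ ≤ ∫⁻ _, ENNReal.ofReal (2 * Real.exp (3 / 4 * d * p.M) + K) ∂ν := by
          refine lintegral_mono_ae ?_
          have hae : ∀ᵐ x ∂ν, x ∈ p.feasible := hν
          filter_upwards [hae] with x hx
          rw [if_pos hx]
          refine ENNReal.ofReal_le_ofReal ?_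
          have h1 : e 0 ≤ 1 := Real.exp_le_one_iff.2
            (mul_nonpos_of_nonneg_of_nonpos hk.le (by simp))
          have h0 : 0 ≤ e 0 := Real.exp_nonneg _
          have h2 : W 0 x ≤ 2 * Real.exp (3 / 4 * d * p.M) := by
            refine (p.lyapunov_bounds (D := D) hρ0.le hρ1 (β 0) x).2.trans ?_
            have h3 : β 0 = d := by simp [β]
            rw [h3]
            have := gap_le hx
            gcongr
          have h4 := hW0 0 x
          nlinarith
      _ = _ := by simp

/-! ### Non-explosion, cost and Markov's inequality. -/

/-- The process does not explode: almost surely, every time lies between two successive jump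
times. -/
lemma ae_exists_jump (σ : NSASchedule) (ν : Measure E) [IsProbabilityMeasure ν] (T : ℝ≥0) :
    ∀ᵐ h ∂(p.law σ ν), ∃ k, (h k).2.1 ≤ T ∧ T < (h (k + 1)).2.1 := by
  have h0 : ∀ᵐ h ∂(p.law σ ν), (h 0).2.1 = 0 := by
    refine ae_of_ae_map (f := fun h : ℕ → E × ℝ≥0 × ℕ => h 0) (p := fun s => s.2.1 = 0)
      (measurable_pi_apply 0).aemeasurable ?_
    rw [law_map_zero, ae_map_iff (by fun_prop) (measurableSet_eq_fun (by fun_prop) (by fun_prop))]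
    simp
  -- With unit costs this bounds the mean number of jumps. The horizon T + 1 turns "at most T" into
  -- a strict inequality.
  have hfin := p.lintegral_cost_le σ ν (T + 1) (fun _ => 1) (m := fun _ => 1) (P := fun r => r)
    (fun r => by simp) (fun _ _ => zero_le_one) continuous_const (fun r => hasDerivAt_id r)
  have hae : ∀ᵐ h ∂(p.law σ ν),
      ∑' k : ℕ, (if (h (k + 1)).2.1 < T + 1 then (1 : ℝ≥0∞) else 0) < ∞ := by
    refine ae_lt_top (Measurable.tsum fun k => ?_) (hfin.trans_lt ENNReal.ofReal_lt_top).ne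
    exact Measurable.ite (measurableSet_lt (by fun_prop) (by fun_prop)) measurable_const
      measurable_const
  filter_upwards [h0, hae] with h h0 hlt
  have hex : ∃ k, T < (h (k + 1)).2.1 := by
    by_contra! hcon
    refine hlt.ne ?_
    have : ∀ k, (h (k + 1)).2.1 < T + 1 := fun k => (hcon k).trans_lt (lt_add_one T)
    simp only [this, if_true]
    exact ENNReal.tsum_const_eq_top_of_ne_zero one_ne_zero
  classical
  refine ⟨Nat.find hex, ?_, Nat.find_spec hex⟩
  rcases Nat.eq_zero_or_pos (Nat.find hex) with hz | hz
  · rw [hz, h0]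
    exact zero_le
  · have := Nat.find_min hex (Nat.sub_lt hz one_pos)
    rwa [not_lt, Nat.sub_add_cancel (show 1 ≤ Nat.find hex from hz)] at this

lemma expectedCost_polySchedule_le (d : ℝ≥0) (b : ℝ) (ν : Measure E) [IsProbabilityMeasure ν]
    (T : ℝ≥0) : p.expectedCost (polySchedule d b) ν T
      ≤ ENNReal.ofReal (T + ((1 + T) ^ 3 - 1) / 3) := by
  refine (p.lintegral_cost_le (polySchedule d b) ν T (fun N => N)
    (m := fun r => 1 + (1 + r) ^ 2) (P := fun r => r + (1 + r) ^ 3 / 3)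
    (fun r => ?_) (fun r _ => by positivity) (by fun_prop) (fun r => ?_)).trans (le_of_eq ?_)
  · rw [lintegral_sizeKernel_id]
    simp [polySchedule]
  · have h1 : HasDerivAt (fun r : ℝ => 1 + r) 1 r := (hasDerivAt_id r).const_add 1
    refine ((hasDerivAt_id r).add ((h1.pow 3).div_const 3)).congr_deriv ?_
    norm_num
  · congr 1
    ring

/-- Markov's inequality for the exponential of the gap. -/
lemma le_probAt_nearOptimal (σ : NSASchedule) (ν : Measure E) [IsProbabilityMeasure ν] (T : ℝ≥0)
    [DecidablePred (· ∈ p.feasible)] {s ε δ K : ℝ} (hδ : 0 < δ) (hK : 0 < K)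
    (hbound : ∫⁻ h, ∑' k : ℕ, (if (h k).2.1 ≤ T ∧ T < (h (k + 1)).2.1 then
          (if (h k).1 ∈ p.feasible then ENNReal.ofReal (Real.exp (s * p.gap (h k).1)) else ∞)
          else 0) ∂(p.law σ ν) ≤ ENNReal.ofReal K)
    (hε : ∀ x ∈ p.feasible, x ∉ p.nearOptimal ε → K / δ ≤ Real.exp (s * p.gap x)) :
    ENNReal.ofReal (1 - δ) ≤ p.probAt σ ν T (p.nearOptimal ε) := by
  set bad : Set (ℕ → E × ℝ≥0 × ℕ) :=
    {h | ∃ k, (h k).2.1 ≤ T ∧ T < (h (k + 1)).2.1 ∧ (h k).1 ∉ p.nearOptimal ε}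
  have hbad : p.law σ ν bad ≤ ENNReal.ofReal δ := by
    have hmeas : Measurable fun h : ℕ → E × ℝ≥0 × ℕ =>
        ∑' k : ℕ, (if (h k).2.1 ≤ T ∧ T < (h (k + 1)).2.1 then
          (if (h k).1 ∈ p.feasible then ENNReal.ofReal (Real.exp (s * p.gap (h k).1)) else ∞)
          else 0) := by
      refine Measurable.tsum fun k => Measurable.ite ?_ ?_ measurable_const
      · exact (measurableSet_le (by fun_prop) (by fun_prop)).inter
          (measurableSet_lt (by fun_prop) (by fun_prop))
      · exact (measurable_of_finite (fun x : E => if x ∈ p.feasible then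
          ENNReal.ofReal (Real.exp (s * p.gap x)) else ∞)).comp (by fun_prop)
    have hKδ : 0 < K / δ := by positivity
    have hmarkov := (mul_meas_ge_le_lintegral hmeas (μ := p.law σ ν)
      (ENNReal.ofReal (K / δ))).trans hbound
    have hsub : p.law σ ν bad ≤ p.law σ ν {h | ENNReal.ofReal (K / δ) ≤
        ∑' k : ℕ, (if (h k).2.1 ≤ T ∧ T < (h (k + 1)).2.1 then
          (if (h k).1 ∈ p.feasible then ENNReal.ofReal (Real.exp (s * p.gap (h k).1)) else ∞)
          else 0)} := by
      refine measure_mono ?_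
      rintro h ⟨k, h1, h2, h3⟩
      refine le_trans ?_ (ENNReal.le_tsum k)
      rw [if_pos ⟨h1, h2⟩]
      split_ifs with hf
      · exact ENNReal.ofReal_le_ofReal (hε _ hf h3)
      · exact le_top
    have h4 := (mul_le_mul_right hsub (ENNReal.ofReal (K / δ))).trans hmarkov
    have h5 : ENNReal.ofReal K = ENNReal.ofReal (K / δ) * ENNReal.ofReal δ := by
      rw [← ENNReal.ofReal_mul hKδ.le, div_mul_cancel₀ _ hδ.ne']
    rw [h5] at h4
    exact (ENNReal.mul_le_mul_iff_right (ENNReal.ofReal_pos.2 hKδ).ne' ENNReal.ofReal_ne_top).1 h4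
  have huniv : 1 ≤ p.probAt σ ν T (p.nearOptimal ε) + p.law σ ν bad := by
    refine le_trans ?_ (measure_union_le _ _)
    rw [← measure_univ (μ := p.law σ ν)]
    refine measure_mono_ae ?_
    filter_upwards [p.ae_exists_jump σ ν T] with h ⟨k, h1, h2⟩ _
    by_cases h3 : (h k).1 ∈ p.nearOptimal ε
    · exact Or.inl ⟨k, h1, h2, h3⟩
    · exact Or.inr ⟨k, h1, h2, h3⟩
  rw [ENNReal.ofReal_sub _ hδ.le, ENNReal.ofReal_one]
  exact tsub_le_iff_right.2 (huniv.trans (add_le_add_right hbad _))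

end NSASetting

end

/-! ### Choice of the constants. -/

theorem mainTheorem4 {E Ω : Type*} [Fintype E] [DecidableEq E] [MeasurableSpace E]
    [MeasurableSingletonClass E] [MeasurableSpace Ω] (p : NSASetting E Ω)
    (hm : p.mStar = 0) :
    ∃ c : ℝ≥0, 0 < c ∧ ∀ (d : ℝ≥0) (b : ℝ), 0 < d → (0 < b ∧ b < 1 ∨ b = 1 ∧ d < c) →
      ∃ δ₀ : ℝ, 0 < δ₀ ∧ δ₀ < 1 ∧ ∀ δ : ℝ, 0 < δ → δ ≤ δ₀ → ∀ ε : ℝ, 0 < ε →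
        ∀ (ν : Measure E) [IsProbabilityMeasure ν], ν p.feasibleᶜ = 0 →
          ∀ T : ℝ≥0, T = Real.toNNReal ((2 * Real.log (1 / δ) / (d * ε)) ^ (1 / b) - 1) →
            ENNReal.ofReal (1 - δ) ≤ p.probAt (polySchedule d b) ν T (p.nearOptimal ε) ∧
            p.expectedCost (polySchedule d b) ν T
              ≤ ENNReal.ofReal ((2 * Real.log (1 / δ) / (d * ε)) ^ (3 / b)) := by
  classical
  obtain ⟨c₁, hc₁, h1⟩ := p.exists_lintegral_exp_gap_le hm 1
  -- For b = 1 the moment bound is used with d₁ = 1, which makes the threshold depend on the setting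
  -- only; for b < 1 it is used below with d₁ = d.
  refine ⟨min 1 c₁.toNNReal, lt_min one_pos (Real.toNNReal_pos.2 hc₁), fun d b hd hb => ?_⟩
  have hb0 : 0 < b := hb.elim (fun h => h.1) (fun h => h.1 ▸ one_pos)
  obtain ⟨K, hK, hbound⟩ : ∃ K : ℝ, 0 < K ∧ ∀ (ν : Measure E) [IsProbabilityMeasure ν] (T : ℝ≥0),
      ν p.feasibleᶜ = 0 → ∫⁻ h, ∑' k : ℕ, (if (h k).2.1 ≤ T ∧ T < (h (k + 1)).2.1 then
          (if (h k).1 ∈ p.feasible then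
            ENNReal.ofReal (Real.exp (3 / 4 * (d * (1 + T) ^ b) * p.gap (h k).1)) else ∞) else 0)
          ∂(p.law (polySchedule d b) ν) ≤ ENNReal.ofReal K := by
    rcases hb with ⟨-, hb⟩ | ⟨rfl, hdc⟩
    · obtain ⟨c, -, h2⟩ := p.exists_lintegral_exp_gap_le hm d
      obtain ⟨K, hK, h3⟩ := h2 d b hd le_rfl hb0 hb.le (fun h => absurd h hb.ne)
      exact ⟨K, hK, fun ν _ T hν => h3 ν T hν⟩
    · have hd1 : d ≤ 1 := hdc.le.trans (min_le_left _ _)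
      have hdc₁ : (d : ℝ) ≤ c₁ := (Real.le_toNNReal_iff_coe_le hc₁.le).1
        (hdc.le.trans (min_le_right _ _))
      obtain ⟨K, hK, h3⟩ := h1 d 1 hd hd1 one_pos le_rfl (fun _ => hdc₁)
      exact ⟨K, hK, fun ν _ T hν => h3 ν T hν⟩
  obtain ⟨Δ, hΔ, hgap⟩ := p.exists_gap_lower
  have hM : (0 : ℝ) < p.M := p.M_pos
  -- Chosen so that log K ≤ lΔ/(2M). For a gap above ε, β M ≥ β ε ≥ 2l and gap ≥ Δ give β gap/4 ≥
  -- lΔ/(2M), so a quarter of β gap absorbs `K` for every ε.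
  set l₀ := max 1 (2 * p.M * Real.log K / Δ)
  refine ⟨Real.exp (-l₀), Real.exp_pos _,
    Real.exp_lt_one_iff.2 (neg_lt_zero.2 (one_pos.trans_le (le_max_left _ _))), ?_⟩
  intro δ hδ hδ₀ ε hε ν _ hν T hT
  have hd' : (0 : ℝ) < d := hd
  set l := Real.log (1 / δ) with hl
  have hl₀ : l₀ ≤ l := by
    rw [hl, one_div, Real.log_inv]
    have := Real.log_le_log hδ hδ₀
    rw [Real.log_exp] at this
    linarith
  have hlpos : 0 < l := one_pos.trans_le ((le_max_left _ _).trans hl₀)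
  set B := 2 * l / (d * ε) with hB
  have hB0 : 0 < B := by positivity
  have hBT : B ^ (1 / b) ≤ 1 + T := by
    have := Real.le_coe_toNNReal (B ^ (1 / b) - 1)
    rw [← hT] at this
    linarith
  have hβ : 2 * l ≤ d * (1 + T) ^ b * ε := by
    have h2 : B ≤ (1 + (T : ℝ)) ^ b := by
      have h3 : (B ^ (1 / b)) ^ b ≤ (1 + (T : ℝ)) ^ b :=
        Real.rpow_le_rpow (by positivity) hBT hb0.le
      rwa [← Real.rpow_mul hB0.le, one_div_mul_cancel hb0.ne', Real.rpow_one] at h3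
    rw [hB, div_le_iff₀ (by positivity)] at h2
    linarith
  refine ⟨p.le_probAt_nearOptimal _ ν T hδ hK (hbound ν T hν) fun x hx hxε => ?_,
    (p.expectedCost_polySchedule_le d b ν T).trans (ENNReal.ofReal_le_ofReal ?_)⟩
  · rw [p.mem_nearOptimal_iff hx hε.le, not_le] at hxε
    have hΔx := hgap x (hε.trans hxε)
    have hxM := NSASetting.gap_le hx
    set β := (d : ℝ) * (1 + T) ^ b
    have hβ0 : 0 < β := by positivity
    have h2 : β * ε ≤ β * p.gap x := mul_le_mul_of_nonneg_left hxε.le hβ0.le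
    have h3 : Real.log K ≤ l * Δ / (2 * p.M) := by
      have h4 := (le_max_right _ _).trans hl₀
      rw [div_le_iff₀ hΔ] at h4
      rw [le_div_iff₀ (by positivity)]
      linarith
    have h4 : l * Δ / (2 * p.M) ≤ β * p.gap x / 4 := by
      rw [div_le_div_iff₀ (by positivity) (by norm_num)]
      have h5 : β * ε ≤ β * p.M := mul_le_mul_of_nonneg_left (hxε.le.trans hxM) hβ0.le
      have h6 : 2 * l * Δ ≤ β * p.M * p.gap x :=
        mul_le_mul (hβ.trans h5) hΔx hΔ.le (by positivity)
      linarith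
    have h5 : K / δ = Real.exp (Real.log K + l) := by
      rw [Real.exp_add, Real.exp_log hK, hl, Real.exp_log (by positivity), mul_one_div]
    rw [h5, Real.exp_le_exp]
    linarith
  · have hB3 : B ^ (3 / b) = (B ^ (1 / b)) ^ 3 := by
      rw [← Real.rpow_natCast, ← Real.rpow_mul hB0.le]
      congr 1
      push_cast
      ring
    rw [hB3]
    rcases le_or_gt (B ^ (1 / b)) 1 with hle | hgt
    · have hT0 : T = 0 := by
        rw [hT, Real.toNNReal_eq_zero]
        linarith
      rw [hT0]
      norm_num
      positivity
    · have hTe : (T : ℝ) = B ^ (1 / b) - 1 := by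
        rw [hT, Real.coe_toNNReal _ (by linarith)]
      rw [hTe]
      set u := B ^ (1 / b)
      -- This reads 3u ≤ u³ + 2 with u = 1 + T, which brings u - 1 + (u³ - 1)/3 below u³.
      have hs : 0 ≤ (u - 1) ^ 2 * (u + 2) := by positivity
      ring_nf at hs ⊢
      linarith
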